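/- Let $\mathsf{RCA}_0^\omega$ be the classical theory in the language of all finite types (with $0$, successor, the combinators $\Pi,\Sigma$ of all types and the recursor $R_0$ with $R_0\,0\,y\,z=y$, $R_0(x+1)yz=z(R_0xyz)x$; only equality of type $0$ is primitive, equality of higher type is defined extensionally) whose axioms are the equality axioms for type $0$, full extensionality, the successor axioms, the defining equations of the constants, quantifier-free induction, and quantifier-free choice $\mathsf{QF\text{-}AC}^{1,0}$. Let $(\mu)$ be the sentence $\exists\mu^2\,\forall f^1\,(\exists x\,f(x)=0\to f(\mu(f))=0)$. Sets $X\subseteq\mathbb N$ are represented by functions of type $1$, with $n\in X$ iff $X(n)=0$; $X\cap Y$ is the pointwise maximum. A countable algebra is a sequence $\mathcal A=(A_i)_{i\in\mathbb N}$ of sets such that the collection $\{A_i\mid i\in\mathbb N\}$ is closed under complements, finite unions and finite intersections. A collection $\mathcal F\subseteq\mathcal A$ is a partial non-principal ultrafilter for $\mathcal A$ if for all $X,Y\in\mathcal A$: $X\in\mathcal F$ or $\overline X\in\mathcal F$; $X\cap Y\in\mathcal F$ implies $Y\in\mathcal F$; $X,Y\in\mathcal F$ implies $X\cap Y\in\mathcal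 F$; and every $X\in\mathcal F$ is infinite; moreover, if $\mathcal F$ is given by a characteristic functional of type $2$ (with $X\in\mathcal F$ iff $\mathcal F(X)=0$), then $\mathcal F(X)=\mathcal F(\lambda n.\min(X(n),1))$ for all $X$. It is countable if it is given as $\mathcal F=\{F_i\mid i\in\mathbb N\}$ by a sequence $(F_i)_{i\in\mathbb N}$. Then $\mathsf{RCA}_0^\omega+(\mu)$ proves: for every countable algebra $\mathcal A$, every countable partial non-principal ultrafilter $\mathcal F=(F_i)_{i\in\mathbb N}$ for $\mathcal A$ and every countable algebra $\tilde{\mathcal A}=(\tilde A_i)_{i\in\mathbb N}\supseteq\mathcal A$ there is a partial non-principal ultrafilter $\tilde{\mathcal F}\supseteq\mathcal F$ for $\tilde{\mathcal A}$, given by a characteristic functional of type $2$. Moreover, $\tilde{\mathcal F}$ can be taken of the form \[ \tilde{\mathcal F}=\mathcal F\cup\{\tilde A_i\mid b(i)=0\}, \] where $b$ is an infinite branch of the $\Pi^0_2$ tree of all finite $0/1$-sequences $x$ such that, for every $j$, there are infinitely many $z\in F_j$ with $z\in\tilde A_i\leftrightarrow x_i=0$ for all $i<\mathrm{lth}(x)$.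 -/

import Mathlib

/-!
Arithmetic in all finite types: syntax, classical natural deduction, the theory `RCA₀^ω`, the
axiom `(μ)`, and the formulas that speak about algebras of sets of natural numbers and partial
non-principal ultrafilters.

Terms and formulas are intrinsically typed, with de Bruijn variables.
-/

namespace FinTypes

/-- The finite types: `nat` is the type `0`, and `ρ ⇾ τ` is the type of functions from `ρ` to `τ`
(also written `τ(ρ)`). -/
inductive Ty : Type
  | nat : Ty
  | arr : Ty → Ty → Ty

local infixr:60 " ⇾ " => Ty.arr

/-- The type `1` of functions on the natural numbers (also used for sets of natural numbers). -/
abbrev Ty.one : Ty := Ty.nat ⇾ Ty.nat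

/-- The type `2`. -/
abbrev Ty.two : Ty := Ty.one ⇾ Ty.nat

/-- The type of sequences of sets of natural numbers. -/
abbrev Ty.seq : Ty := Ty.nat ⇾ Ty.one

/-- A context lists the types of the free variables. -/
abbrev Ctx : Type := List Ty

inductive Var : Ctx → Ty → Type
  | z {Γ : Ctx} {ρ : Ty} : Var (ρ :: Γ) ρ
  | s {Γ : Ctx} {ρ σ : Ty} : Var Γ ρ → Var (σ :: Γ) ρ

/-- Terms over `0`, the successor, the combinators `Π` and `Σ` of all types, and the recursor
`R₀` of type `0`. -/
inductive Tm (Γ : Ctx) : Ty → Type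
  | var {ρ : Ty} : Var Γ ρ → Tm Γ ρ
  | app {ρ τ : Ty} : Tm Γ (ρ ⇾ τ) → Tm Γ ρ → Tm Γ τ
  | zero : Tm Γ Ty.nat
  | succ : Tm Γ Ty.one
  | combPi (ρ τ : Ty) : Tm Γ (ρ ⇾ τ ⇾ ρ)
  | combSigma (ρ σ τ : Ty) : Tm Γ ((ρ ⇾ σ ⇾ τ) ⇾ (ρ ⇾ σ) ⇾ ρ ⇾ τ)
  | recursor : Tm Γ (Ty.nat ⇾ Ty.nat ⇾ (Ty.nat ⇾ Ty.nat ⇾ Ty.nat) ⇾ Ty.nat)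

local infixl:75 " ⬝ " => Tm.app

/-- Formulas; the only primitive relation is equality of type `0`. -/
inductive Fm : Ctx → Type
  | eq {Γ : Ctx} : Tm Γ Ty.nat → Tm Γ Ty.nat → Fm Γ
  | bot {Γ : Ctx} : Fm Γ
  | imp {Γ : Ctx} : Fm Γ → Fm Γ → Fm Γ
  | all {Γ : Ctx} (ρ : Ty) : Fm (ρ :: Γ) → Fm Γ

local infix:50 " ≐ " => Fm.eq
local infixr:30 " ⇒ " => Fm.imp

/-! ### Renaming and substitution -/

abbrev Ren (Γ Δ : Ctx) : Type := ∀ ⦃ρ : Ty⦄, Var Γ ρ → Var Δ ρ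

abbrev Sub (Γ Δ : Ctx) : Type := ∀ ⦃ρ : Ty⦄, Var Γ ρ → Tm Δ ρ

def Ren.lift {Γ Δ : Ctx} (r : Ren Γ Δ) (σ : Ty) : Ren (σ :: Γ) (σ :: Δ)
  | _, Var.z => Var.z
  | _, Var.s x => Var.s (r x)

def Tm.ren {Γ Δ : Ctx} (r : Ren Γ Δ) : {ρ : Ty} → Tm Γ ρ → Tm Δ ρ
  | _, .var x => .var (r x)
  | _, .app s t => .app (s.ren r) (t.ren r)
  | _, .zero => .zero
  | _, .succ => .succ
  | _, .combPi ρ τ => .combPi ρ τ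
  | _, .combSigma ρ σ τ => .combSigma ρ σ τ
  | _, .recursor => .recursor

/-- Weakening of a term by one new variable. -/
def Tm.up {Γ : Ctx} {σ ρ : Ty} (t : Tm Γ ρ) : Tm (σ :: Γ) ρ :=
  t.ren (fun _ x => Var.s x)

def Sub.lift {Γ Δ : Ctx} (f : Sub Γ Δ) (σ : Ty) : Sub (σ :: Γ) (σ :: Δ)
  | _, Var.z => .var Var.z
  | _, Var.s x => (f x).up

def Tm.sub {Γ Δ : Ctx} (f : Sub Γ Δ) : {ρ : Ty} → Tm Γ ρ → Tm Δ ρ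
  | _, .var x => f x
  | _, .app s t => .app (s.sub f) (t.sub f)
  | _, .zero => .zero
  | _, .succ => .succ
  | _, .combPi ρ τ => .combPi ρ τ
  | _, .combSigma ρ σ τ => .combSigma ρ σ τ
  | _, .recursor => .recursor

def Fm.ren : {Γ Δ : Ctx} → Ren Γ Δ → Fm Γ → Fm Δ
  | _, _, r, .eq s t => .eq (s.ren r) (t.ren r)
  | _, _, _, .bot => .bot
  | _, _, r, .imp A B => .imp (A.ren r) (B.ren r)
  | _, _, r, .all ρ A => .all ρ (A.ren (r.lift ρ))

def Fm.sub : {Γ Δ : Ctx} → Sub Γ Δ → Fm Γ → Fm Δ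
  | _, _, f, .eq s t => .eq (s.sub f) (t.sub f)
  | _, _, _, .bot => .bot
  | _, _, f, .imp A B => .imp (A.sub f) (B.sub f)
  | _, _, f, .all ρ A => .all ρ (A.sub (f.lift ρ))

/-- Weakening of a formula by one new variable. -/
def Fm.up {Γ : Ctx} {σ : Ty} (A : Fm Γ) : Fm (σ :: Γ) :=
  A.ren (fun _ x => Var.s x)

/-- The substitution of `t` for the last variable, the others being mapped by `f`. -/
def Sub.cons {Γ Δ : Ctx} {σ : Ty} (t : Tm Δ σ) (f : Sub Γ Δ) : Sub (σ :: Γ) Δ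
  | _, Var.z => t
  | _, Var.s x => f x

/-- `A.inst t` is `A[t]`. -/
def Fm.inst {Γ : Ctx} {σ : Ty} (A : Fm (σ :: Γ)) (t : Tm Γ σ) : Fm Γ :=
  A.sub (Sub.cons t (fun _ x => .var x))

/-! ### Derived connectives, variables, equality of higher type -/

section Abbreviations

variable {Γ : Ctx}

def Fm.neg (A : Fm Γ) : Fm Γ := A ⇒ .bot
def Fm.and (A B : Fm Γ) : Fm Γ := (A ⇒ B.neg).neg
def Fm.or (A B : Fm Γ) : Fm Γ := A.neg ⇒ B
def Fm.iff (A B : Fm Γ) : Fm Γ := (A ⇒ B).and (B ⇒ A)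
def Fm.ex (ρ : Ty) (A : Fm (ρ :: Γ)) : Fm Γ := (Fm.all ρ A.neg).neg

/-- The variables bound by the innermost quantifier, the next one, and so on. -/
def v0 {ρ : Ty} : Tm (ρ :: Γ) ρ := .var .z
def v1 {ρ σ : Ty} : Tm (σ :: ρ :: Γ) ρ := .var (.s .z)
def v2 {ρ σ τ : Ty} : Tm (τ :: σ :: ρ :: Γ) ρ := .var (.s (.s .z))
def v3 {ρ σ τ υ : Ty} : Tm (υ :: τ :: σ :: ρ :: Γ) ρ := .var (.s (.s (.s .z)))
def v4 {ρ σ τ υ φ : Ty} : Tm (φ :: υ :: τ :: σ :: ρ :: Γ) ρ := .var (.s (.s (.s (.s .z))))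

end Abbreviations

local infixr:35 " ⩓ " => Fm.and
local infixr:33 " ⩔ " => Fm.or
local infix:28 " ⇔ " => Fm.iff

/-- Equality at type `ρ`, defined extensionally: `s =_{ρ ⇾ τ} t` is `∀ x, s x =_τ t x`. -/
def Fm.eqAt : (ρ : Ty) → {Γ : Ctx} → Tm Γ ρ → Tm Γ ρ → Fm Γ
  | .nat, _, s, t => s ≐ t
  | .arr ρ τ, _, s, t => .all ρ (Fm.eqAt τ (s.up ⬝ v0) (t.up ⬝ v0))

/-- Quantifier-free formulas. -/
def Fm.QF : {Γ : Ctx} → Fm Γ → Prop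
  | _, .eq _ _ => True
  | _, .bot => True
  | _, .imp A B => A.QF ∧ B.QF
  | _, .all _ _ => False

/-! ### Classical natural deduction -/

/-- A (possibly open) formula is an axiom or not; an open axiom stands for its universal
closure. -/
abbrev Theory : Type := ∀ ⦃Γ : Ctx⦄, Fm Γ → Prop

/-- `Der T H A`: the formula `A` is derivable in many-sorted classical predicate logic from the
axioms of `T` and the open assumptions `H`. -/
inductive Der (T : Theory) : {Γ : Ctx} → List (Fm Γ) → Fm Γ → Prop
  | ax {Γ : Ctx} {H : List (Fm Γ)} {A : Fm Γ} : T A → Der T H A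
  | hyp {Γ : Ctx} {H : List (Fm Γ)} {A : Fm Γ} : A ∈ H → Der T H A
  | impI {Γ : Ctx} {H : List (Fm Γ)} {A B : Fm Γ} : Der T (A :: H) B → Der T H (A ⇒ B)
  | impE {Γ : Ctx} {H : List (Fm Γ)} {A B : Fm Γ} : Der T H (A ⇒ B) → Der T H A → Der T H B
  | raa {Γ : Ctx} {H : List (Fm Γ)} {A : Fm Γ} : Der T (A.neg :: H) .bot → Der T H A
  | allI {Γ : Ctx} {H : List (Fm Γ)} {ρ : Ty} {A : Fm (ρ :: Γ)} :
      Der T (H.map Fm.up) A → Der T H (.all ρ A)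
  | allE {Γ : Ctx} {H : List (Fm Γ)} {ρ : Ty} {A : Fm (ρ :: Γ)} :
      Der T H (.all ρ A) → (t : Tm Γ ρ) → Der T H (A.inst t)

/-- `T` proves the sentence `A`. -/
def Theory.Proves (T : Theory) (A : Fm []) : Prop := Der T [] A

/-- The theory `T` together with the sentence `B` as a further axiom. -/
inductive Theory.Plus (T : Theory) (B : Fm []) : Theory
  | old {Γ : Ctx} {A : Fm Γ} : T A → Theory.Plus T B A
  | new : Theory.Plus T B B

/-! ### The theory `RCA₀^ω` -/

/-- The axioms of `RCA₀^ω`: equality of type `0`, extensionality in all types, the successor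
axioms, the defining equations of `Π`, `Σ` and `R₀`, quantifier-free induction and
quantifier-free choice `QF-AC^{1,0}` (both with arbitrary parameters). -/
inductive RCA : Theory
  | refl {Γ : Ctx} (s : Tm Γ Ty.nat) : RCA (s ≐ s)
  | symm {Γ : Ctx} (s t : Tm Γ Ty.nat) : RCA (s ≐ t ⇒ t ≐ s)
  | trans {Γ : Ctx} (s t u : Tm Γ Ty.nat) : RCA (s ≐ t ⇒ t ≐ u ⇒ s ≐ u)
  | ext {Γ : Ctx} {ρ τ : Ty} (f : Tm Γ (ρ ⇾ τ)) (s t : Tm Γ ρ) :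
      RCA (Fm.eqAt ρ s t ⇒ Fm.eqAt τ (f ⬝ s) (f ⬝ t))
  | succ_ne_zero {Γ : Ctx} (s : Tm Γ Ty.nat) : RCA (Fm.neg (.succ ⬝ s ≐ .zero))
  | succ_inj {Γ : Ctx} (s t : Tm Γ Ty.nat) : RCA (.succ ⬝ s ≐ .succ ⬝ t ⇒ s ≐ t)
  | combPi {Γ : Ctx} {ρ τ : Ty} (s : Tm Γ ρ) (t : Tm Γ τ) :
      RCA (Fm.eqAt ρ (.combPi ρ τ ⬝ s ⬝ t) s)
  | combSigma {Γ : Ctx} {ρ σ τ : Ty} (s : Tm Γ (ρ ⇾ σ ⇾ τ)) (t : Tm Γ (ρ ⇾ σ)) (u : Tm Γ ρ) :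
      RCA (Fm.eqAt τ (.combSigma ρ σ τ ⬝ s ⬝ t ⬝ u) (s ⬝ u ⬝ (t ⬝ u)))
  | rec_zero {Γ : Ctx} (y : Tm Γ Ty.nat) (z : Tm Γ (Ty.nat ⇾ Ty.nat ⇾ Ty.nat)) :
      RCA (.recursor ⬝ .zero ⬝ y ⬝ z ≐ y)
  | rec_succ {Γ : Ctx} (x y : Tm Γ Ty.nat) (z : Tm Γ (Ty.nat ⇾ Ty.nat ⇾ Ty.nat)) :
      RCA (.recursor ⬝ (.succ ⬝ x) ⬝ y ⬝ z ≐ z ⬝ (.recursor ⬝ x ⬝ y ⬝ z) ⬝ x)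
  /-- `A(0) → ∀ x (A(x) → A(x + 1)) → ∀ x A(x)` -/
  | induction {Γ : Ctx} (A : Fm (Ty.nat :: Γ)) : A.QF →
      RCA (A.inst .zero ⇒
        .all Ty.nat (A ⇒ A.sub (Sub.cons (.succ ⬝ v0) (fun _ x => .var (.s x)))) ⇒
        .all Ty.nat A)
  /-- `∀ f ∃ x A(f, x) → ∃ F ∀ f A(f, F f)` -/
  | choice {Γ : Ctx} (A : Fm (Ty.nat :: Ty.one :: Γ)) : A.QF →
      RCA (.all Ty.one (.ex Ty.nat A) ⇒
        .ex Ty.two (.all Ty.one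
          (A.sub (Sub.cons (v1 ⬝ v0) (Sub.cons v0 (fun _ x => .var (.s (.s x))))))))

/-- `(μ)`: there is `μ` of type `2` such that `f (μ f) = 0` whenever `∃ x, f x = 0`. -/
def muAxiom : Fm [] :=
  .ex Ty.two (.all Ty.one
    (.ex Ty.nat (v1 ⬝ v0 ≐ .zero) ⇒ v0 ⬝ (v1 ⬝ v0) ≐ .zero))

/-! ### Lambda abstraction and some primitive recursive functions -/

/-- Lambda abstraction, by means of the combinators. -/
def Tm.lam {Γ : Ctx} {ρ : Ty} : {τ : Ty} → Tm (ρ :: Γ) τ → Tm Γ (ρ ⇾ τ)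
  | _, .var .z => .combSigma ρ (ρ ⇾ ρ) ρ ⬝ .combPi ρ (ρ ⇾ ρ) ⬝ .combPi ρ ρ
  | _, .var (.s x) => .combPi _ ρ ⬝ .var x
  | _, .app s t => .combSigma ρ _ _ ⬝ s.lam ⬝ t.lam
  | _, .zero => .combPi _ ρ ⬝ .zero
  | _, .succ => .combPi _ ρ ⬝ .succ
  | _, .combPi σ τ => .combPi _ ρ ⬝ .combPi σ τ
  | _, .combSigma σ τ υ => .combPi _ ρ ⬝ .combSigma σ τ υ
  | _, .recursor => .combPi _ ρ ⬝ .recursor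

section Arithmetic

variable {Γ : Ctx}

def Tm.add (s t : Tm Γ Ty.nat) : Tm Γ Ty.nat :=
  .recursor ⬝ t ⬝ s ⬝ Tm.lam (Tm.lam (.succ ⬝ v1))

def Tm.pred (s : Tm Γ Ty.nat) : Tm Γ Ty.nat :=
  .recursor ⬝ s ⬝ .zero ⬝ Tm.lam (Tm.lam v0)

/-- Truncated subtraction. -/
def Tm.monus (s t : Tm Γ Ty.nat) : Tm Γ Ty.nat :=
  .recursor ⬝ t ⬝ s ⬝ Tm.lam (Tm.lam (Tm.pred v1))

def Tm.max (s t : Tm Γ Ty.nat) : Tm Γ Ty.nat := s.add (t.monus s)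
def Tm.min (s t : Tm Γ Ty.nat) : Tm Γ Ty.nat := s.monus (s.monus t)
def Tm.num1 : Tm Γ Ty.nat := .succ ⬝ .zero

/-- `s < t` -/
def Fm.lt (s t : Tm Γ Ty.nat) : Fm Γ := Tm.monus (.succ ⬝ s) t ≐ .zero

/-! ### Sets of natural numbers -/

/-- `s ∈ X`, where `X` is viewed as a characteristic function: `X s = 0`. -/
def Fm.elt (s : Tm Γ Ty.nat) (X : Tm Γ Ty.one) : Fm Γ := X ⬝ s ≐ .zero

def Tm.inter (X Y : Tm Γ Ty.one) : Tm Γ Ty.one := Tm.lam (Tm.max (X.up ⬝ v0) (Y.up ⬝ v0))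
def Tm.union (X Y : Tm Γ Ty.one) : Tm Γ Ty.one := Tm.lam (Tm.min (X.up ⬝ v0) (Y.up ⬝ v0))
def Tm.compl (X : Tm Γ Ty.one) : Tm Γ Ty.one := Tm.lam (Tm.monus Tm.num1 (X.up ⬝ v0))

/-- `λ n. min (X n) 1` -/
def Tm.normalize (X : Tm Γ Ty.one) : Tm Γ Ty.one := Tm.lam (Tm.min (X.up ⬝ v0) Tm.num1)

/-- `X` and `Y` are the same set. -/
def Fm.setEq (X Y : Tm Γ Ty.one) : Fm Γ := .all Ty.nat (.elt v0 X.up ⇔ .elt v0 Y.up)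

/-- `∀ n ∃ k > n, k ∈ X` -/
def Fm.infinite (X : Tm Γ Ty.one) : Fm Γ :=
  .all Ty.nat (.ex Ty.nat (Fm.lt v1 v0 ⩓ .elt v0 X.up.up))

end Arithmetic

/-- A collection of sets of natural numbers: either the countable collection enumerated by a
sequence of sets, or the collection given by a characteristic functional of type `2`. -/
inductive Coll (Γ : Ctx) : Type
  | enum : Tm Γ Ty.seq → Coll Γ
  | char : Tm Γ Ty.two → Coll Γ

def Coll.up {Γ : Ctx} {σ : Ty} : Coll Γ → Coll (σ :: Γ)
  | .enum A => .enum A.up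
  | .char U => .char U.up

/-- `X` is a member of the collection: `∃ i, X = A_i`, respectively `U X = 0`. -/
def Fm.mem {Γ : Ctx} (X : Tm Γ Ty.one) : Coll Γ → Fm Γ
  | .enum A => .ex Ty.nat (.setEq X.up (A.up ⬝ v0))
  | .char U => U ⬝ X ≐ .zero

section Ultrafilters

variable {Γ : Ctx}

def Fm.subColl (C D : Coll Γ) : Fm Γ := .all Ty.one (.mem v0 C.up ⇒ .mem v0 D.up)

/-- `C` is closed under complements, unions and intersections. -/
def Fm.algebra (C : Coll Γ) : Fm Γ :=
  .all Ty.one (.mem v0 C.up ⇒ .mem (Tm.compl v0) C.up) ⩓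
  .all Ty.one (.all Ty.one
    (.mem v1 C.up.up ⩓ .mem v0 C.up.up ⇒ .mem (Tm.union v1 v0) C.up.up)) ⩓
  .all Ty.one (.all Ty.one
    (.mem v1 C.up.up ⩓ .mem v0 C.up.up ⇒ .mem (Tm.inter v1 v0) C.up.up))

/-- Membership depends only on the set, not on its characteristic function. For a characteristic
functional this is `∀ X, U X = U (λ n. min (X n) 1)`. -/
def Fm.wellDefined : Coll Γ → Fm Γ
  | .enum A => .all Ty.one (.mem v0 (.enum A.up) ⇔ .mem (Tm.normalize v0) (.enum A.up))
  | .char U => .all Ty.one (U.up ⬝ v0 ≐ U.up ⬝ Tm.normalize v0)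

/-- `F` is a partial non-principal ultrafilter for `C`. -/
def Fm.partialUltrafilter (C F : Coll Γ) : Fm Γ :=
  .subColl F C ⩓
  .all Ty.one (.mem v0 C.up ⇒ .mem v0 F.up ⩔ .mem (Tm.compl v0) F.up) ⩓
  .all Ty.one (.all Ty.one (.mem v1 C.up.up ⩓ .mem v0 C.up.up ⇒
    .mem (Tm.inter v1 v0) F.up.up ⇒ .mem v0 F.up.up)) ⩓
  .all Ty.one (.all Ty.one (.mem v1 C.up.up ⩓ .mem v0 C.up.up ⇒
    .mem v1 F.up.up ⩓ .mem v0 F.up.up ⇒ .mem (Tm.inter v1 v0) F.up.up)) ⩓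
  .all Ty.one (.mem v0 C.up ⇒ .mem v0 F.up ⇒ .infinite v0) ⩓
  .wellDefined F

/-- `b` is an infinite branch of the tree of all 0/1-sequences `x` such that for every `j` the
set `A^x ∩ F_j` is infinite, where `A^x` is the intersection over `i < lth x` of `A_i` (if
`x_i = 0`) and of the complement of `A_i` (if `x_i = 1`):
`b` is 0/1-valued, and for all `n`, `j`, `y` there is `z > y` with `z ∈ F_j` and
`z ∈ A_i ↔ b i = 0` for all `i < n`. -/
def Fm.branch (A F : Tm Γ Ty.seq) (b : Tm Γ Ty.one) : Fm Γ :=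
  .all Ty.nat (b.up ⬝ v0 ≐ .zero ⩔ b.up ⬝ v0 ≐ Tm.num1) ⩓
  .all Ty.nat (.all Ty.nat (.all Ty.nat (.ex Ty.nat
    (Fm.lt v1 v0 ⩓ .elt v0 (F.up.up.up.up ⬝ v2) ⩓
      .all Ty.nat (Fm.lt v0 v4 ⇒
        (.elt v1 (A.up.up.up.up.up ⬝ v0) ⇔ b.up.up.up.up.up ⬝ v0 ≐ .zero))))))

/-- `U = {F_j | j ∈ ℕ} ∪ {A_i | b i = 0}` -/
def Fm.generated (A F : Tm Γ Ty.seq) (b : Tm Γ Ty.one) (U : Tm Γ Ty.two) : Fm Γ :=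
  .all Ty.one (.mem v0 (.char U.up) ⇔
    .mem v0 (.enum F.up) ⩔
    .ex Ty.nat (b.up.up ⬝ v0 ≐ .zero ⩓ .setEq v1 (A.up.up ⬝ v0)))

end Ultrafilters

/-- For all sequences `A`, `F` such that `A` is an algebra and `F` a partial non-principal
ultrafilter for `A`, and for every sequence `B` that is an algebra extending `A`, there are `b`
and `U` such that `U` is a partial non-principal ultrafilter for `B` extending `F`, and moreover
`b` is a branch of the tree given by `B` and `F`, and `U = F ∪ {B_i | b i = 0}`. -/
def extensionSentence : Fm [] :=
  .all Ty.seq (.all Ty.seq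
    (.algebra (.enum v1) ⩓ .partialUltrafilter (.enum v1) (.enum v0) ⇒
      .all Ty.seq (.algebra (.enum v0) ⩓ .subColl (.enum v2) (.enum v0) ⇒
        .ex Ty.one (.ex Ty.two
          (.partialUltrafilter (.enum v2) (.char v0) ⩓
            .subColl (.enum v3) (.char v0) ⩓
            .branch v2 v3 v1 ⩓
            .generated v2 v3 v1 v0)))))

end FinTypes

/-!
Derivability of a sentence reduces to its truth in all extensional models, by Henkin's completeness
theorem for the many-sorted calculus: the axioms of equality and extensionality make the quotient
of the term model by provable equality an extensional structure.

In an extensional model, `QF-AC^{1,0}` provides characteristic functions for the equations between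
terms, and `μ` eliminates number quantifiers. Hence arithmetical predicates, also with function
arguments, have characteristic functions, which yields arithmetical comprehension, induction, and
dependent choice.

Let `B` be an algebra and `F` a downward directed sequence of infinite members of `B`. A node of
the tree of length `n` is coded by a number that realizes its pattern in `B_0, …, B_{n-1}`. If
neither successor of a node belonged to the tree, then `F_i` and `F_j` would witness this, and so
would any `F_k ⊆ F_i ∩ F_j` witness that the node itself does not belong to the tree. Dependent
choice thus gives a branch `b`. For any finitely many members of `B` there are arbitrarily large
numbers that belong to exactly those that are in `{F_j} ∪ {B_i | b i = 0}`, and each of the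
conditions on an ultrafilter can be read off from such a number.
-/

namespace FinTypes

local infixr:60 " ⇾ " => Ty.arr
local infixl:75 " ⬝ " => Tm.app
local infix:50 " ≐ " => Fm.eq
local infixr:30 " ⇒ " => Fm.imp
local infixr:35 " ⩓ " => Fm.and
local infixr:33 " ⩔ " => Fm.or
local infix:28 " ⇔ " => Fm.iff

/-! ### Substitution and derivations -/

section Substitution

variable {Γ Δ Θ : Ctx} {σ ρ : Ty}

/-- The identity substitution. -/
abbrev Sub.id (Γ : Ctx) : Sub Γ Γ := fun _ x => .var x

/-- A renaming as a substitution of variables for variables. -/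
abbrev Sub.ofRen (r : Ren Γ Δ) : Sub Γ Δ := fun _ x => .var (r x)

/-- The inclusion of a context into its extension by one variable. -/
abbrev Sub.shift (Γ : Ctx) (σ : Ty) : Sub Γ (σ :: Γ) := fun _ x => .var (.s x)

/-- Composition of substitutions in diagrammatic order: first `f`, then `g`. -/
def Sub.comp (f : Sub Γ Δ) (g : Sub Δ Θ) : Sub Γ Θ := fun _ x => (f x).sub g

theorem Sub.ext_cons {f g : Sub (σ :: Γ) Δ} (hz : f Var.z = g Var.z)
    (hs : ∀ ⦃ρ : Ty⦄ (x : Var Γ ρ), f (Var.s x) = g (Var.s x)) : f = g := by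
  funext ρ x
  cases x with
  | z => exact hz
  | s x => exact hs x

theorem Tm.ren_eq_sub (r : Ren Γ Δ) (t : Tm Γ ρ) : t.ren r = t.sub (Sub.ofRen r) := by
  induction t <;> simp_all only [Tm.ren, Tm.sub]

theorem Tm.up_eq_sub (t : Tm Γ ρ) : (t.up : Tm (σ :: Γ) ρ) = t.sub (Sub.shift Γ σ) :=
  Tm.ren_eq_sub _ t

theorem Tm.sub_sub (f : Sub Γ Δ) (g : Sub Δ Θ) (t : Tm Γ ρ) :
    (t.sub f).sub g = t.sub (f.comp g) := by
  induction t <;> simp_all only [Tm.sub, Sub.comp]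

@[simp] theorem Tm.sub_id (t : Tm Γ ρ) : t.sub (Sub.id Γ) = t := by
  induction t <;> simp_all only [Tm.sub]

theorem Sub.comp_id (f : Sub Γ Δ) : f.comp (Sub.id Δ) = f := by
  funext ρ x
  exact Tm.sub_id _

theorem Sub.comp_assoc {Ξ : Ctx} (f : Sub Γ Δ) (g : Sub Δ Θ) (h : Sub Θ Ξ) :
    (f.comp g).comp h = f.comp (g.comp h) := by
  funext ρ x
  exact Tm.sub_sub _ _ _

theorem Sub.lift_ofRen (r : Ren Γ Δ) (σ : Ty) :
    (Sub.ofRen r).lift σ = Sub.ofRen (r.lift σ) :=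
  Sub.ext_cons rfl fun _ _ => rfl

theorem Sub.lift_id (Γ : Ctx) (σ : Ty) : (Sub.id Γ).lift σ = Sub.id (σ :: Γ) :=
  Sub.ext_cons rfl fun _ _ => rfl

theorem Sub.shift_comp_lift (f : Sub Γ Δ) (σ : Ty) :
    (Sub.shift Γ σ).comp (f.lift σ) = f.comp (Sub.shift Δ σ) := by
  funext ρ x
  exact Tm.up_eq_sub _

theorem Sub.shift_shift_comp_lift_lift (f : Sub Γ Δ) (σ τ : Ty) :
    Sub.comp (fun _ x => .var (.s (.s x))) ((f.lift σ).lift τ) =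
      f.comp fun _ x => .var (.s (.s x)) := by
  funext ρ x
  change (f x).up.up = (f x).sub _
  rw [Tm.up_eq_sub, Tm.up_eq_sub, Tm.sub_sub]
  rfl

theorem Sub.lift_comp_lift (f : Sub Γ Δ) (g : Sub Δ Θ) (σ : Ty) :
    (f.lift σ).comp (g.lift σ) = (f.comp g).lift σ := by
  refine Sub.ext_cons rfl fun ρ x => ?_
  change (f x).up.sub (g.lift σ) = ((f x).sub g).up
  rw [Tm.up_eq_sub, Tm.up_eq_sub, Tm.sub_sub, Tm.sub_sub, Sub.shift_comp_lift]

theorem Sub.shift_comp_cons (t : Tm Δ σ) (f : Sub Γ Δ) :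
    (Sub.shift Γ σ).comp (Sub.cons t f) = f := rfl

theorem Tm.up_sub_cons (t : Tm Δ σ) (f : Sub Γ Δ) (s : Tm Γ ρ) :
    s.up.sub (Sub.cons t f) = s.sub f := by
  rw [Tm.up_eq_sub, Tm.sub_sub, Sub.shift_comp_cons]

theorem Sub.lift_comp_cons (f : Sub Γ Δ) (t : Tm Θ σ) (g : Sub Δ Θ) :
    (f.lift σ).comp (Sub.cons t g) = Sub.cons t (f.comp g) :=
  Sub.ext_cons rfl fun _ x => Tm.up_sub_cons t g (f x)

theorem Sub.cons_comp (t : Tm Δ σ) (f : Sub Γ Δ) (g : Sub Δ Θ) :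
    (Sub.cons t f).comp g = Sub.cons (t.sub g) (f.comp g) :=
  Sub.ext_cons rfl fun _ _ => rfl

theorem Fm.ren_eq_sub (r : Ren Γ Δ) (A : Fm Γ) : A.ren r = A.sub (Sub.ofRen r) := by
  induction A generalizing Δ with
  | eq s t => simp only [Fm.ren, Fm.sub, Tm.ren_eq_sub]
  | bot => rfl
  | imp A B hA hB => simp only [Fm.ren, Fm.sub, hA, hB]
  | all ρ A hA => simp only [Fm.ren, Fm.sub, hA, Sub.lift_ofRen]

theorem Fm.up_eq_sub (A : Fm Γ) : (A.up : Fm (σ :: Γ)) = A.sub (Sub.shift Γ σ) :=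
  Fm.ren_eq_sub _ A

theorem Fm.sub_sub (f : Sub Γ Δ) (g : Sub Δ Θ) (A : Fm Γ) :
    (A.sub f).sub g = A.sub (f.comp g) := by
  induction A generalizing Δ Θ with
  | eq s t => simp only [Fm.sub, Tm.sub_sub]
  | bot => rfl
  | imp A B hA hB => simp only [Fm.sub, hA, hB]
  | all ρ A hA => simp only [Fm.sub, hA, Sub.lift_comp_lift]

@[simp] theorem Fm.sub_id (A : Fm Γ) : A.sub (Sub.id Γ) = A := by
  induction A with
  | eq s t => simp only [Fm.sub, Tm.sub_id]
  | bot => rfl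
  | imp A B hA hB => simp only [Fm.sub, hA, hB]
  | all ρ A hA => simp only [Fm.sub, Sub.lift_id, hA]

theorem Fm.up_sub_lift (f : Sub Γ Δ) (σ : Ty) (A : Fm Γ) :
    A.up.sub (f.lift σ) = (A.sub f).up := by
  rw [Fm.up_eq_sub, Fm.up_eq_sub, Fm.sub_sub, Fm.sub_sub, Sub.shift_comp_lift]

theorem Fm.sub_lift_inst (f : Sub Γ Δ) (A : Fm (σ :: Γ)) (t : Tm Δ σ) :
    (A.sub (f.lift σ)).inst t = A.sub (Sub.cons t f) := by
  rw [Fm.inst, Fm.sub_sub, Sub.lift_comp_cons, Sub.comp_id]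

theorem Fm.inst_sub (f : Sub Γ Δ) (A : Fm (σ :: Γ)) (t : Tm Γ σ) :
    (A.inst t).sub f = A.sub (Sub.cons (t.sub f) f) := by
  rw [Fm.inst, Fm.sub_sub, Sub.cons_comp]
  rfl

theorem Fm.eqAt_sub (f : Sub Γ Δ) (s t : Tm Γ ρ) :
    (Fm.eqAt ρ s t).sub f = Fm.eqAt ρ (s.sub f) (t.sub f) := by
  induction ρ generalizing Γ Δ with
  | nat => rfl
  | arr ρ τ _ ih =>
    simp only [Fm.eqAt, Fm.sub, ih, Tm.sub, Tm.up_eq_sub, Tm.sub_sub, Sub.shift_comp_lift]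
    rfl

theorem Fm.QF.sub (f : Sub Γ Δ) {A : Fm Γ} (h : A.QF) : (A.sub f).QF := by
  induction A generalizing Δ with
  | eq s t => trivial
  | bot => trivial
  | imp A B hA hB => exact ⟨hA f h.1, hB f h.2⟩
  | all ρ A _ => exact h.elim

end Substitution

/-- The theory is closed under substitution: every instance of an open axiom is an axiom. -/
def Theory.SubClosed (T : Theory) : Prop :=
  ∀ ⦃Γ Δ : Ctx⦄ (f : Sub Γ Δ) (A : Fm Γ), T A → T (A.sub f)

theorem RCA.subClosed : Theory.SubClosed RCA := by
  intro Γ Δ f A h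
  cases h with
  | refl s => exact .refl _
  | symm s t => exact .symm _ _
  | trans s t u => exact .trans _ _ _
  | ext g s t =>
    simp only [Fm.sub, Fm.eqAt_sub, Tm.sub]
    exact .ext _ _ _
  | succ_ne_zero s => exact .succ_ne_zero _
  | succ_inj s t => exact .succ_inj _ _
  | combPi s t =>
    simp only [Fm.eqAt_sub, Tm.sub]
    exact .combPi _ _
  | combSigma s t u =>
    simp only [Fm.eqAt_sub, Tm.sub]
    exact .combSigma _ _ _
  | rec_zero y z => exact .rec_zero _ _
  | rec_succ x y z => exact .rec_succ _ _ _
  | induction A hA =>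
    convert RCA.induction (A.sub (f.lift Ty.nat)) (hA.sub _) using 1
    simp only [Fm.sub, Fm.inst_sub, Fm.sub_lift_inst, Fm.sub_sub, Sub.lift_comp_cons,
      Sub.cons_comp]
    have hshift : Sub.comp (Sub.shift Γ Ty.nat) (f.lift Ty.nat) =
        f.comp (Sub.shift Δ Ty.nat) := Sub.shift_comp_lift f _
    rw [hshift]
    rfl
  | choice A hA =>
    convert RCA.choice (A.sub ((f.lift Ty.one).lift Ty.nat)) (hA.sub _) using 1
    simp only [Fm.sub, Fm.ex, Fm.neg, Fm.sub_sub, Sub.lift_comp_cons, Sub.cons_comp]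
    have hshift : Sub.comp (fun _ x => .var (.s (.s x))) ((f.lift Ty.two).lift Ty.one) =
        f.comp fun _ x => .var (.s (.s x)) := Sub.shift_shift_comp_lift_lift f _ _
    rw [hshift]
    rfl

section Rules

variable {T : Theory} {Γ : Ctx}

theorem Der.weaken {H K : List (Fm Γ)} {A : Fm Γ} (h : Der T H A) (hHK : H ⊆ K) :
    Der T K A := by
  induction h with
  | ax h => exact .ax h
  | hyp h => exact .hyp (hHK h)
  | impI _ ih => exact .impI (ih (List.cons_subset_cons _ hHK))
  | impE _ _ ih₁ ih₂ => exact .impE (ih₁ hHK) (ih₂ hHK)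
  | raa _ ih => exact .raa (ih (List.cons_subset_cons _ hHK))
  | allI _ ih => exact .allI (ih (List.map_subset _ hHK))
  | allE _ t ih => exact .allE (ih hHK) t

theorem Der.mono {T' : Theory} {H : List (Fm Γ)} {A : Fm Γ} (h : Der T H A)
    (hT : ∀ ⦃Δ : Ctx⦄ (B : Fm Δ), T B → T' B) : Der T' H A := by
  induction h with
  | ax h => exact .ax (hT _ h)
  | hyp h => exact .hyp h
  | impI _ ih => exact .impI ih
  | impE _ _ ih₁ ih₂ => exact .impE ih₁ ih₂
  | raa _ ih => exact .raa ih
  | allI _ ih => exact .allI ih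
  | allE _ t ih => exact .allE ih t

theorem Der.sub (hT : T.SubClosed) {Δ : Ctx} {H : List (Fm Γ)} {A : Fm Γ} (h : Der T H A)
    (f : Sub Γ Δ) : Der T (H.map (Fm.sub f)) (A.sub f) := by
  induction h generalizing Δ with
  | ax h => exact .ax (hT f _ h)
  | hyp h => exact .hyp (List.mem_map_of_mem h)
  | impI _ ih => exact .impI (ih f)
  | impE _ _ ih₁ ih₂ => exact .impE (ih₁ f) (ih₂ f)
  | raa _ ih => exact .raa (ih f)
  | @allI Γ H ρ A _ ih =>
    refine .allI ?_
    have hlift := ih (f.lift ρ)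
    rw [List.map_map] at hlift ⊢
    convert hlift using 2
    funext B
    exact (Fm.up_sub_lift f ρ B).symm
  | allE _ t ih =>
    rw [Fm.inst_sub, ← Fm.sub_lift_inst]
    exact .allE (ih f) _

theorem Der.up (hT : T.SubClosed) {σ : Ty} {H : List (Fm Γ)} {A : Fm Γ} (h : Der T H A) :
    Der T (H.map Fm.up) (A.up : Fm (σ :: Γ)) := by
  have hup : (Fm.up : Fm Γ → Fm (σ :: Γ)) = Fm.sub (Sub.shift Γ σ) := funext Fm.up_eq_sub
  rw [hup]
  exact h.sub hT _

theorem Der.exfalso {H : List (Fm Γ)} {A : Fm Γ} (h : Der T H .bot) : Der T H A :=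
  .raa (h.weaken (List.subset_cons_self _ _))

end Rules

section Countability

variable {Γ : Ctx} {ρ τ : Ty}

/-- Gödel numbers of types. -/
def Ty.code : Ty → ℕ
  | .nat => 0
  | .arr ρ τ => Nat.pair ρ.code τ.code + 1

theorem Ty.code_injective : Function.Injective Ty.code := by
  intro ρ
  induction ρ <;> intro σ h <;> cases σ <;> grind [Ty.code, Nat.pair_eq_pair]

instance : Countable Ty := Ty.code_injective.countable

instance : Nonempty Ty := ⟨.nat⟩

/-- The de Bruijn index of a variable. -/
def Var.code {Γ : Ctx} {ρ : Ty} : Var Γ ρ → ℕ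
  | .z => 0
  | .s x => x.code + 1

theorem Var.heq_of_code_eq (x : Var Γ ρ) (y : Var Γ τ) (h : x.code = y.code) :
    ρ = τ ∧ x ≍ y := by
  induction x <;> cases y <;> grind [Var.code]

/-- Gödel numbers of terms. -/
def Tm.code {ρ : Ty} : Tm Γ ρ → ℕ
  | .var x => Nat.pair 0 x.code
  | .app s t => Nat.pair 1 (Nat.pair s.code t.code)
  | .zero => Nat.pair 2 0
  | .succ => Nat.pair 3 0
  | .combPi ρ τ => Nat.pair 4 (Nat.pair ρ.code τ.code)
  | .combSigma ρ σ τ => Nat.pair 5 (Nat.pair ρ.code (Nat.pair σ.code τ.code))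
  | .recursor => Nat.pair 6 0

/-- Terms of different types are compared because the type of the argument of an application
cannot be read off the application. -/
theorem Tm.heq_of_code_eq (s : Tm Γ ρ) (t : Tm Γ τ) (h : s.code = t.code) :
    ρ = τ ∧ s ≍ t := by
  induction s generalizing τ <;> cases t <;> simp only [Tm.code, Nat.pair_eq_pair] at h <;>
    grind [→ Var.heq_of_code_eq, Ty.code_injective.eq_iff]

/-- Gödel numbers of formulas. -/
def Fm.code {Γ : Ctx} : Fm Γ → ℕ
  | .eq s t => Nat.pair 0 (Nat.pair s.code t.code)
  | .bot => Nat.pair 1 0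
  | .imp A B => Nat.pair 2 (Nat.pair A.code B.code)
  | .all ρ A => Nat.pair 3 (Nat.pair ρ.code A.code)

theorem Fm.code_injective : Function.Injective (Fm.code (Γ := Γ)) := by
  intro A
  induction A <;> intro B h <;> cases B <;> simp only [Fm.code, Nat.pair_eq_pair] at h <;>
    grind [→ Tm.heq_of_code_eq, Ty.code_injective.eq_iff, Function.Injective]

instance : Countable (Fm Γ) := Fm.code_injective.countable

end Countability

/-! ### Semantics -/

/-- Structures for the language of all finite types. Nothing is required of the operations; the
axioms are imposed by `Str.Ext` and `Str.Models`. -/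
structure Str where
  C : Ty → Type
  app : {ρ τ : Ty} → C (ρ ⇾ τ) → C ρ → C τ
  zero : C Ty.nat
  succ : C Ty.one
  combPi (ρ τ : Ty) : C (ρ ⇾ τ ⇾ ρ)
  combSigma (ρ σ τ : Ty) : C ((ρ ⇾ σ ⇾ τ) ⇾ (ρ ⇾ σ) ⇾ ρ ⇾ τ)
  recursor : C (Ty.nat ⇾ Ty.nat ⇾ (Ty.nat ⇾ Ty.nat ⇾ Ty.nat) ⇾ Ty.nat)

local infixl:75 " ⋄ " => Str.app _

/-- Assignments of elements of the structure to the variables of a context. -/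
abbrev Str.Env (M : Str) (Γ : Ctx) : Type := ∀ ⦃ρ : Ty⦄, Var Γ ρ → M.C ρ

section Semantics

variable {M : Str} {Γ : Ctx} {ρ σ τ υ φ : Ty}

/-- The empty assignment. -/
def Str.Env.nil : M.Env [] := fun _ x => nomatch x

/-- The extension of an assignment by a value for a new variable `0`. -/
def Str.Env.cons (a : M.C σ) (e : M.Env Γ) : M.Env (σ :: Γ)
  | _, Var.z => a
  | _, Var.s x => e x

/-- The value of a term under an assignment. -/
def Tm.eval (e : M.Env Γ) : {ρ : Ty} → Tm Γ ρ → M.C ρ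
  | _, .var x => e x
  | _, .app s t => s.eval e ⋄ t.eval e
  | _, .zero => M.zero
  | _, .succ => M.succ
  | _, .combPi ρ τ => M.combPi ρ τ
  | _, .combSigma ρ σ τ => M.combSigma ρ σ τ
  | _, .recursor => M.recursor

/-- Tarski's satisfaction relation. -/
def Fm.Sat : {Γ : Ctx} → Fm Γ → M.Env Γ → Prop
  | _, .eq s t, e => s.eval e = t.eval e
  | _, .bot, _ => False
  | _, .imp A B, e => A.Sat e → B.Sat e
  | _, .all _ A, e => ∀ a, A.Sat (Str.Env.cons a e)

/-- The structure is extensional: functions with the same values are equal. -/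
def Str.Ext (M : Str) : Prop :=
  ∀ ⦃ρ τ : Ty⦄ (f g : M.C (ρ ⇾ τ)), (∀ x, f ⋄ x = g ⋄ x) → f = g

/-- The structure is a model of the theory: all axioms hold under all assignments. -/
def Str.Models (M : Str) (T : Theory) : Prop :=
  ∀ ⦃Γ : Ctx⦄ (A : Fm Γ), T A → ∀ e : M.Env Γ, A.Sat e

theorem Str.Env.eq_nil (e : M.Env []) : e = .nil := by
  funext ρ x
  cases x

theorem Tm.eval_sub {Δ : Ctx} (f : Sub Γ Δ) (e : M.Env Δ) (t : Tm Γ ρ) :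
    (t.sub f).eval e = t.eval (fun _ x => (f x).eval e) := by
  induction t <;> simp_all only [Tm.sub, Tm.eval]

@[simp] theorem Tm.eval_up (a : M.C σ) (e : M.Env Γ) (t : Tm Γ ρ) :
    t.up.eval (.cons a e) = t.eval e := by
  rw [Tm.up_eq_sub, Tm.eval_sub]
  rfl

@[simp] theorem Tm.eval_app (s : Tm Γ (ρ ⇾ τ)) (t : Tm Γ ρ) (e : M.Env Γ) :
    (s ⬝ t).eval e = s.eval e ⋄ t.eval e := rfl

@[simp] theorem Tm.eval_zero (e : M.Env Γ) : (Tm.zero : Tm Γ _).eval e = M.zero := rfl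

@[simp] theorem Tm.eval_succ (e : M.Env Γ) : (Tm.succ : Tm Γ _).eval e = M.succ := rfl

@[simp] theorem eval_v0 (a : M.C ρ) (e : M.Env Γ) :
    (v0 : Tm (ρ :: Γ) ρ).eval (.cons a e) = a := rfl

@[simp] theorem eval_v1 (a : M.C ρ) (b : M.C σ) (e : M.Env Γ) :
    (v1 : Tm (σ :: ρ :: Γ) ρ).eval (.cons b (.cons a e)) = a := rfl

@[simp] theorem eval_v2 (a : M.C ρ) (b : M.C σ) (c : M.C τ) (e : M.Env Γ) :
    (v2 : Tm (τ :: σ :: ρ :: Γ) ρ).eval (.cons c (.cons b (.cons a e))) = a := rfl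

@[simp] theorem eval_v3 (a : M.C ρ) (b : M.C σ) (c : M.C τ) (d : M.C υ) (e : M.Env Γ) :
    (v3 : Tm (υ :: τ :: σ :: ρ :: Γ) ρ).eval (.cons d (.cons c (.cons b (.cons a e)))) = a := rfl

@[simp] theorem eval_v4 (a : M.C ρ) (b : M.C σ) (c : M.C τ) (d : M.C υ) (d' : M.C φ)
    (e : M.Env Γ) :
    (v4 : Tm (φ :: υ :: τ :: σ :: ρ :: Γ) ρ).eval
      (.cons d' (.cons d (.cons c (.cons b (.cons a e))))) = a := rfl

@[simp] theorem Fm.sat_eq (s t : Tm Γ Ty.nat) (e : M.Env Γ) :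
    (s ≐ t).Sat e ↔ s.eval e = t.eval e := Iff.rfl

@[simp] theorem Fm.sat_imp (A B : Fm Γ) (e : M.Env Γ) :
    (A ⇒ B).Sat e ↔ (A.Sat e → B.Sat e) := Iff.rfl

@[simp] theorem Fm.sat_all (A : Fm (ρ :: Γ)) (e : M.Env Γ) :
    (Fm.all ρ A).Sat e ↔ ∀ a, A.Sat (.cons a e) := Iff.rfl

@[simp] theorem Fm.sat_neg (A : Fm Γ) (e : M.Env Γ) : A.neg.Sat e ↔ ¬ A.Sat e := Iff.rfl

@[simp] theorem Fm.sat_and (A B : Fm Γ) (e : M.Env Γ) :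
    (A ⩓ B).Sat e ↔ A.Sat e ∧ B.Sat e := by
  simp only [Fm.and, Fm.sat_neg, Fm.sat_imp]
  tauto

@[simp] theorem Fm.sat_or (A B : Fm Γ) (e : M.Env Γ) :
    (A ⩔ B).Sat e ↔ A.Sat e ∨ B.Sat e := by
  simp only [Fm.or, Fm.sat_neg, Fm.sat_imp]
  tauto

@[simp] theorem Fm.sat_iff (A B : Fm Γ) (e : M.Env Γ) :
    (A ⇔ B).Sat e ↔ (A.Sat e ↔ B.Sat e) := by
  simp only [Fm.iff, Fm.sat_and, Fm.sat_imp]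
  tauto

@[simp] theorem Fm.sat_ex (A : Fm (ρ :: Γ)) (e : M.Env Γ) :
    (Fm.ex ρ A).Sat e ↔ ∃ a, A.Sat (.cons a e) := by
  simp only [Fm.ex, Fm.sat_neg, Fm.sat_all, not_forall, not_not]

theorem Fm.sat_eqAt (hM : M.Ext) (s t : Tm Γ ρ) (e : M.Env Γ) :
    (Fm.eqAt ρ s t).Sat e ↔ s.eval e = t.eval e := by
  induction ρ generalizing Γ with
  | nat => rfl
  | arr ρ τ _ ih =>
    simp only [Fm.eqAt, Fm.sat_all, ih, Tm.eval_app, Tm.eval_up, eval_v0]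
    exact ⟨hM _ _, fun h a => by rw [h]⟩

end Semantics

/-! ### Completeness -/

/-- The theory contains the axioms for equality of type `0` and full extensionality. -/
structure Theory.HasEq (T : Theory) : Prop where
  refl : ∀ ⦃Γ : Ctx⦄ (s : Tm Γ Ty.nat), T (s ≐ s)
  symm : ∀ ⦃Γ : Ctx⦄ (s t : Tm Γ Ty.nat), T (s ≐ t ⇒ t ≐ s)
  trans : ∀ ⦃Γ : Ctx⦄ (s t u : Tm Γ Ty.nat), T (s ≐ t ⇒ t ≐ u ⇒ s ≐ u)
  ext : ∀ ⦃Γ : Ctx⦄ ⦃ρ τ : Ty⦄ (f : Tm Γ (ρ ⇾ τ)) (s t : Tm Γ ρ),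
    T (Fm.eqAt ρ s t ⇒ Fm.eqAt τ (f ⬝ s) (f ⬝ t))

/-- A finite set of open assumptions is consistent with the theory `T`. -/
def Consistent (T : Theory) {Γ : Ctx} (H : List (Fm Γ)) : Prop := ¬ Der T H .bot

/-- A closed term of each type; the types of the language are therefore all inhabited. -/
def Tm.default {Γ : Ctx} : (ρ : Ty) → Tm Γ ρ
  | .nat => .zero
  | .arr _ τ => .combPi _ _ ⬝ Tm.default τ

section Consistency

variable {T : Theory} {Γ : Ctx} {H : List (Fm Γ)}

theorem Consistent.map_up (h : Consistent T H) (σ : Ty) :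
    Consistent T (H.map Fm.up : List (Fm (σ :: Γ))) :=
  fun hbot => h (.allE (A := .bot) (.allI hbot) (Tm.default σ))

/-- If `A` itself cannot be refuted, then `∀ x A` is already derivable: the variable that extends
the context is the Henkin witness. -/
theorem Consistent.exists_extension_deciding_all (hT : T.SubClosed) (h : Consistent T H)
    {σ : Ty} (A : Fm (σ :: Γ)) :
    ∃ K : List (Fm (σ :: Γ)), Consistent T K ∧ H.map Fm.up ⊆ K ∧
      (Der T K (Fm.all σ A).up ∨ A.neg ∈ K) := by
  by_cases hA : Consistent T (A.neg :: H.map Fm.up)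
  · exact ⟨_, hA, List.subset_cons_self _ _, .inr List.mem_cons_self⟩
  · have hall : Der T H (.all σ A) := .allI (.raa (not_not.1 hA))
    exact ⟨_, h.map_up σ, List.Subset.refl _, .inl (hall.up hT)⟩

end Consistency

theorem exists_seq_frequently_eq (α : Type*) [Countable α] [Nonempty α] :
    ∃ f : ℕ → α, ∀ a, ∃ᶠ n in Filter.atTop, f n = a := by
  obtain ⟨g, hg⟩ := exists_surjective_nat α
  refine ⟨fun n => g n.unpair.1, fun a => Filter.frequently_atTop.2 fun N => ?_⟩
  obtain ⟨k, rfl⟩ := hg a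
  exact ⟨Nat.pair k N, Nat.right_le_pair k N, by simp only [Nat.unpair_pair]⟩

namespace Henkin

open Filter

section Stages

/-- At stage `n` of the construction, `schedule n` is the type of the variable to be added together
with the number of a formula in the enumeration of all formulas about such a variable. -/
noncomputable def schedule : ℕ → Ty × ℕ := (exists_seq_frequently_eq (Ty × ℕ)).choose

theorem frequently_schedule_eq (p : Ty × ℕ) : ∃ᶠ n in atTop, schedule n = p :=
  (exists_seq_frequently_eq (Ty × ℕ)).choose_spec p

/-- The type of the variable added at stage `n`. -/
noncomputable def newTy (n : ℕ) : Ty := (schedule n).1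

/-- The context of the variables added before stage `n`. -/
noncomputable def ctx : ℕ → Ctx
  | 0 => []
  | n + 1 => newTy n :: ctx n

/-- The inclusion of the variables of stage `N` into those of stage `n`. -/
noncomputable def incl {N n : ℕ} (h : N ≤ n) : Sub (ctx N) (ctx n) :=
  Nat.leRec (motive := fun k _ => Sub (ctx N) (ctx k)) (Sub.id _)
    (fun k _ f => f.comp (Sub.shift (ctx k) (newTy k))) h

theorem incl_self (N : ℕ) : incl (le_refl N) = Sub.id (ctx N) :=
  Nat.leRec_self _ _

theorem incl_succ {N n : ℕ} (h : N ≤ n) :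
    incl (Nat.le_succ_of_le h) = (incl h).comp (Sub.shift (ctx n) (newTy n)) :=
  Nat.leRec_succ (motive := fun k _ => Sub (ctx N) (ctx k)) _ _ h

theorem sub_incl_succ {N n : ℕ} {ρ : Ty} (h : N ≤ n) (t : Tm (ctx N) ρ) :
    t.sub (incl (Nat.le_succ_of_le h)) = (t.sub (incl h)).up := by
  rw [incl_succ h, Tm.up_eq_sub]
  exact (Tm.sub_sub _ _ t).symm

theorem incl_comp_incl {N n k : ℕ} (h : N ≤ n) (hk : n ≤ k) :
    (incl h).comp (incl hk) = incl (h.trans hk) := by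
  induction k, hk using Nat.le_induction with
  | base => rw [incl_self, Sub.comp_id]
  | succ k hk ih =>
    rw [incl_succ hk, incl_succ (h.trans hk), ← ih]
    exact (Sub.comp_assoc _ _ _).symm

theorem exists_enumeration (ρ : Ty) :
    ∃ f : ℕ → Σ N, Fm (ρ :: ctx N), Function.Surjective f :=
  haveI : Nonempty (Σ N, Fm (ρ :: ctx N)) := ⟨0, .bot⟩
  exists_surjective_nat _

/-- The formula about the new variable that is decided at stage `n`. The value `⊥` is a dummy for
the stages at which the context of the scheduled formula is not yet available. -/
noncomputable def target (n : ℕ) : Fm (newTy n :: ctx n) :=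
  let B := (exists_enumeration (newTy n)).choose (schedule n).2
  if h : B.1 ≤ n then B.2.sub ((incl h).lift _) else .bot

theorem frequently_target_eq {N : ℕ} {ρ : Ty} (A : Fm (ρ :: ctx N)) :
    ∃ᶠ n in atTop, ∃ h : N ≤ n, (⟨newTy n, target n⟩ : Σ ρ, Fm (ρ :: ctx n)) =
      ⟨ρ, A.sub ((incl h).lift ρ)⟩ := by
  obtain ⟨i, hi⟩ := (exists_enumeration ρ).choose_spec ⟨N, A⟩
  refine ((frequently_schedule_eq (ρ, i)).and_eventually (eventually_ge_atTop N)).mono ?_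
  rintro n ⟨hn, hN⟩
  obtain rfl : newTy n = ρ := congrArg Prod.fst hn
  obtain rfl : (schedule n).2 = i := congrArg Prod.snd hn
  refine ⟨hN, ?_⟩
  rw [target]
  generalize (exists_enumeration (newTy n)).choose (schedule n).2 = B at hi
  subst hi
  simp only [hN, dite_true]

end Stages

section Hypotheses

variable {T : Theory} (hT : T.SubClosed) {H₀ : List (Fm [])} (h₀ : Consistent T H₀)

/-- The assumptions made before stage `n`. -/
noncomputable def hyps : (n : ℕ) → {H : List (Fm (ctx n)) // Consistent T H}
  | 0 => ⟨H₀, h₀⟩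
  | n + 1 =>
    let ext := (hyps n).2.exists_extension_deciding_all hT (target n)
    ⟨ext.choose, ext.choose_spec.1⟩

/-- Derivability from the assumptions made before stage `n`. -/
def DerAt (n : ℕ) (A : Fm (ctx n)) : Prop := Der T (hyps hT h₀ n).1 A

theorem derAt_up {n : ℕ} {A : Fm (ctx n)} (h : DerAt hT h₀ n A) : DerAt hT h₀ (n + 1) A.up :=
  Der.weaken (Der.up hT h)
    ((hyps hT h₀ n).2.exists_extension_deciding_all hT (target n)).choose_spec.2.1

theorem derAt_all_target_or_neg (n : ℕ) :
    DerAt hT h₀ (n + 1) (Fm.all _ (target n)).up ∨ DerAt hT h₀ (n + 1) (target n).neg :=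
  ((hyps hT h₀ n).2.exists_extension_deciding_all hT (target n)).choose_spec.2.2.imp id .hyp

end Hypotheses

/-- The terms of the term model: sequences of terms in the contexts of the various stages that
from some stage on are all the same term. -/
structure Elt (ρ : Ty) : Type where
  tm : ∀ n, Tm (ctx n) ρ
  coherent : ∀ᶠ n in atTop, tm (n + 1) = (tm n).up

namespace Elt

/-- A term in the variables of stage `N`, with dummy values at earlier stages. -/
noncomputable def ofTm {N : ℕ} {ρ : Ty} (t : Tm (ctx N) ρ) : Elt ρ where
  tm n := if h : N ≤ n then t.sub (incl h) else Tm.default ρ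
  coherent := by
    filter_upwards [eventually_ge_atTop N] with n hn
    rw [dif_pos (Nat.le_succ_of_le hn), dif_pos hn, sub_incl_succ]

theorem tm_ofTm {N n : ℕ} {ρ : Ty} (t : Tm (ctx N) ρ) (h : N ≤ n) :
    (ofTm t).tm n = t.sub (incl h) := dif_pos h

end Elt

/-- The structure of terms before equality has been divided out. -/
def preModel : Str where
  C := Elt
  app f x := ⟨fun n => f.tm n ⬝ x.tm n, by
    filter_upwards [f.coherent, x.coherent] with n hf hx
    rw [hf, hx]
    rfl⟩
  zero := ⟨fun _ => .zero, .of_forall fun _ => rfl⟩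
  succ := ⟨fun _ => .succ, .of_forall fun _ => rfl⟩
  combPi _ _ := ⟨fun _ => .combPi _ _, .of_forall fun _ => rfl⟩
  combSigma _ _ _ := ⟨fun _ => .combSigma _ _ _, .of_forall fun _ => rfl⟩
  recursor := ⟨fun _ => .recursor, .of_forall fun _ => rfl⟩

section Assignments

variable {Γ : Ctx} {ρ : Ty}

/-- The substitution at stage `n` given by an assignment of terms. -/
def stageSub (e : preModel.Env Γ) (n : ℕ) : Sub Γ (ctx n) := fun _ x => (e x).tm n

theorem stageSub_cons (a : Elt ρ) (e : preModel.Env Γ) (n : ℕ) :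
    stageSub (.cons (M := preModel) a e) n = Sub.cons (a.tm n) (stageSub e n) :=
  Sub.ext_cons rfl fun _ _ => rfl

theorem tm_eval (e : preModel.Env Γ) (t : Tm Γ ρ) (n : ℕ) :
    (t.eval e).tm n = t.sub (stageSub e n) := by
  induction t with
  | app s t ihs iht => exact congrArg₂ Tm.app ihs iht
  | _ => rfl

/-- From stage `N` on, the values of the assignment do not change. -/
def CoherentFrom (e : preModel.Env Γ) (N : ℕ) : Prop :=
  ∀ n (h : N ≤ n), stageSub e n = (stageSub e N).comp (incl h)

theorem exists_coherentFrom (e : preModel.Env Γ) : ∃ N, CoherentFrom e N := by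
  have hsucc : ∀ᶠ n in atTop, ∀ ⦃ρ : Ty⦄ (x : Var Γ ρ), (e x).tm (n + 1) = ((e x).tm n).up := by
    induction Γ with
    | nil => exact .of_forall fun _ _ x => nomatch x
    | cons σ Γ ih =>
      filter_upwards [(e Var.z).coherent, ih fun ρ x => e (Var.s x)] with n hz hs ρ x
      cases x with
      | z => exact hz
      | s x => exact hs x
  obtain ⟨N, hN⟩ := eventually_atTop.1 hsucc
  refine ⟨N, fun n h => ?_⟩
  funext ρ x
  change (e x).tm n = ((e x).tm N).sub (incl h)
  induction n, h using Nat.le_induction with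
  | base => rw [incl_self, Tm.sub_id]
  | succ n h ih => rw [hN n h, ih, sub_incl_succ]

theorem CoherentFrom.mono {e : preModel.Env Γ} {N n : ℕ} (he : CoherentFrom e N) (h : N ≤ n) :
    CoherentFrom e n := fun k hk => by
  rw [he n h, he k (h.trans hk), Sub.comp_assoc, incl_comp_incl]

theorem CoherentFrom.stageSub_succ {e : preModel.Env Γ} {n : ℕ} (he : CoherentFrom e n) :
    stageSub e (n + 1) = (stageSub e n).comp (Sub.shift (ctx n) (newTy n)) := by
  rw [he (n + 1) n.le_succ, incl_succ le_rfl, incl_self]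
  rfl

theorem CoherentFrom.sub_stageSub_succ {e : preModel.Env Γ} {n : ℕ} (he : CoherentFrom e n)
    (A : Fm Γ) : A.sub (stageSub e (n + 1)) = (A.sub (stageSub e n)).up := by
  rw [he.stageSub_succ, Fm.up_eq_sub]
  exact (Fm.sub_sub _ _ A).symm

theorem CoherentFrom.sub_stageSub_cons_new {e : preModel.Env Γ} {n : ℕ} (he : CoherentFrom e n)
    (A : Fm (newTy n :: Γ)) :
    A.sub (stageSub (.cons (M := preModel) (Elt.ofTm (N := n + 1) v0) e) (n + 1)) =
      A.sub ((stageSub e n).lift (newTy n)) := by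
  refine congrArg (Fm.sub · A) (Sub.ext_cons ?_ fun τ x => ?_)
  · exact (Elt.tm_ofTm _ le_rfl).trans (congrArg (Tm.sub · v0) (incl_self (n + 1)))
  · exact (congrFun (congrFun he.stageSub_succ τ) x).trans (Tm.up_eq_sub _).symm

theorem CoherentFrom.cons_ofTm {e : preModel.Env Γ} {n : ℕ} (he : CoherentFrom e n)
    (t : Tm (ctx n) ρ) : CoherentFrom (Str.Env.cons (M := preModel) (Elt.ofTm t) e) n := by
  intro k hk
  rw [stageSub_cons, stageSub_cons, Sub.cons_comp, ← he k hk, Elt.tm_ofTm t hk,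
    Elt.tm_ofTm t le_rfl, incl_self, Tm.sub_id]

end Assignments

section Truth

variable {T : Theory} {hT : T.SubClosed} {H₀ : List (Fm [])} {h₀ : Consistent T H₀}
  {Γ : Ctx} {ρ : Ty}

variable (hT h₀) in
/-- The formula is derivable for the terms assigned to its variables from some stage on. This is
truth in the term model. -/
def Holds (A : Fm Γ) (e : preModel.Env Γ) : Prop :=
  ∀ᶠ n in atTop, DerAt hT h₀ n (A.sub (stageSub e n))

theorem holds_of_derAt {A : Fm Γ} {e : preModel.Env Γ} {N : ℕ} (he : CoherentFrom e N)
    (h : DerAt hT h₀ N (A.sub (stageSub e N))) : Holds hT h₀ A e := by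
  filter_upwards [eventually_ge_atTop N] with n hn
  induction n, hn using Nat.le_induction with
  | base => exact h
  | succ n hn ih =>
    rw [(he.mono hn).sub_stageSub_succ]
    exact derAt_up hT h₀ ih

theorem holds_of_ax {A : Fm Γ} (hA : T A) (e : preModel.Env Γ) : Holds hT h₀ A e :=
  .of_forall fun _ => .ax (hT _ _ hA)

theorem Holds.mp {A B : Fm Γ} {e : preModel.Env Γ} (hAB : Holds hT h₀ (A ⇒ B) e)
    (hA : Holds hT h₀ A e) : Holds hT h₀ B e := by
  filter_upwards [hAB, hA] with n hAB hA using .impE hAB hA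

theorem not_holds_bot (e : preModel.Env Γ) : ¬ Holds hT h₀ .bot e := fun h =>
  let ⟨n, hn⟩ := h.exists
  (hyps hT h₀ n).2 hn

theorem Holds.inst {A : Fm (ρ :: Γ)} {e : preModel.Env Γ} (h : Holds hT h₀ (.all ρ A) e)
    (a : Elt ρ) : Holds hT h₀ A (.cons a e) := by
  filter_upwards [h] with n hn
  rw [stageSub_cons, ← Fm.sub_lift_inst]
  exact .allE hn (a.tm n)

theorem holds_up_cons {A : Fm Γ} {a : Elt ρ} {e : preModel.Env Γ} :
    Holds hT h₀ A.up (.cons a e) ↔ Holds hT h₀ A e := by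
  simp only [Holds, stageSub_cons, Fm.up_eq_sub, Fm.sub_sub, Sub.shift_comp_cons]

variable (hT h₀) in
theorem holds_all_or_exists_holds_neg (A : Fm (ρ :: Γ)) (e : preModel.Env Γ) :
    Holds hT h₀ (.all ρ A) e ∨ ∃ a, Holds hT h₀ A.neg (.cons a e) := by
  obtain ⟨N, hN⟩ := exists_coherentFrom e
  obtain ⟨n, hNn, htarget⟩ := (frequently_target_eq (A.sub ((stageSub e N).lift ρ))).exists
  obtain ⟨rfl, htarget⟩ := Sigma.mk.inj_iff.1 htarget
  rw [Fm.sub_sub, Sub.lift_comp_lift, ← hN n hNn, heq_iff_eq] at htarget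
  have he := hN.mono hNn
  have he' := he.mono n.le_succ
  refine (derAt_all_target_or_neg hT h₀ n).imp (fun h => holds_of_derAt he' ?_) fun h =>
    ⟨Elt.ofTm (N := n + 1) v0, holds_of_derAt (he'.cons_ofTm _) ?_⟩
  · rw [htarget] at h
    rw [he.sub_stageSub_succ]
    exact h
  · rw [htarget] at h
    rw [he.sub_stageSub_cons_new]
    exact h

variable (hT h₀) in
theorem holds_or_holds_neg (A : Fm Γ) (e : preModel.Env Γ) :
    Holds hT h₀ A e ∨ Holds hT h₀ A.neg e := by
  refine (holds_all_or_exists_holds_neg hT h₀ (A.up : Fm (Ty.nat :: Γ)) e).imp (fun h => ?_) ?_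
  · exact holds_up_cons.1 (h.inst preModel.zero)
  · rintro ⟨a, ha⟩
    exact holds_up_cons.1 ha

theorem holds_imp_iff {A B : Fm Γ} {e : preModel.Env Γ} :
    Holds hT h₀ (A ⇒ B) e ↔ (Holds hT h₀ A e → Holds hT h₀ B e) := by
  refine ⟨Holds.mp, fun h => ?_⟩
  rcases holds_or_holds_neg hT h₀ A e with hA | hA
  · filter_upwards [h hA] with n hB
    exact .impI (hB.weaken (List.subset_cons_self _ _))
  · filter_upwards [hA] with n hA
    exact .impI (.exfalso (.impE (hA.weaken (List.subset_cons_self _ _)) (.hyp List.mem_cons_self)))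

theorem holds_all_iff {A : Fm (ρ :: Γ)} {e : preModel.Env Γ} :
    Holds hT h₀ (.all ρ A) e ↔ ∀ a, Holds hT h₀ A (.cons a e) := by
  refine ⟨Holds.inst, fun h => (holds_all_or_exists_holds_neg hT h₀ A e).resolve_right ?_⟩
  rintro ⟨a, ha⟩
  exact not_holds_bot _ (ha.mp (h a))

variable (hT h₀) in
/-- Derivability of `x = y` from some stage on. -/
def Eqv (ρ : Ty) (x y : Elt ρ) : Prop :=
  ∀ᶠ n in atTop, DerAt hT h₀ n (Fm.eqAt ρ (x.tm n) (y.tm n))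

theorem holds_eqAt {s t : Tm Γ ρ} {e : preModel.Env Γ} :
    Holds hT h₀ (Fm.eqAt ρ s t) e ↔ Eqv hT h₀ ρ (s.eval e) (t.eval e) := by
  simp only [Holds, Eqv, Fm.eqAt_sub, tm_eval]

theorem eqv_arr {τ : Ty} {f g : Elt (ρ ⇾ τ)} :
    Eqv hT h₀ (ρ ⇾ τ) f g ↔ ∀ x, Eqv hT h₀ τ (preModel.app f x) (preModel.app g x) := by
  let e : preModel.Env [ρ ⇾ τ, ρ ⇾ τ] := .cons (M := preModel) g (.cons (M := preModel) f .nil)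
  refine (holds_eqAt (s := v1) (t := v0) (e := e)).symm.trans (holds_all_iff.trans ?_)
  refine forall_congr' fun x => holds_eqAt.trans ?_
  simp only [Tm.eval_app, Tm.eval_up, eval_v0]
  rfl

theorem Eqv.refl (hE : T.HasEq) : (ρ : Ty) → (x : Elt ρ) → Eqv hT h₀ ρ x x
  | .nat, _ => .of_forall fun _ => .ax (hE.refl _)
  | .arr _ τ, _ => eqv_arr.2 fun _ => Eqv.refl hE τ _

theorem Eqv.symm (hE : T.HasEq) {x y : Elt ρ} (h : Eqv hT h₀ ρ x y) : Eqv hT h₀ ρ y x := by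
  induction ρ with
  | nat =>
    filter_upwards [h] with n hn using .impE (.ax (hE.symm _ _)) hn
  | arr ρ τ _ ih => exact eqv_arr.2 fun z => ih (eqv_arr.1 h z)

theorem Eqv.trans (hE : T.HasEq) {x y z : Elt ρ} (hxy : Eqv hT h₀ ρ x y)
    (hyz : Eqv hT h₀ ρ y z) : Eqv hT h₀ ρ x z := by
  induction ρ with
  | nat =>
    filter_upwards [hxy, hyz] with n hxy hyz
      using .impE (.impE (.ax (hE.trans _ _ _)) hxy) hyz
  | arr ρ τ _ ih => exact eqv_arr.2 fun w => ih (eqv_arr.1 hxy w) (eqv_arr.1 hyz w)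

theorem Eqv.app (hE : T.HasEq) {τ : Ty} {f g : Elt (ρ ⇾ τ)} {x y : Elt ρ}
    (hfg : Eqv hT h₀ (ρ ⇾ τ) f g) (hxy : Eqv hT h₀ ρ x y) :
    Eqv hT h₀ τ (preModel.app f x) (preModel.app g y) := by
  refine .trans hE (eqv_arr.1 hfg x) ?_
  filter_upwards [hxy] with n hn using .impE (.ax (hE.ext _ _ _)) hn

variable (hT h₀) in
/-- Derivable equality as an equivalence relation. -/
def eqvSetoid (hE : T.HasEq) (ρ : Ty) : Setoid (Elt ρ) where
  r := Eqv hT h₀ ρ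
  iseqv := ⟨Eqv.refl hE ρ, Eqv.symm hE, Eqv.trans hE⟩

variable (hT h₀) in
/-- The term model: the structure of terms modulo derivable equality. -/
def termModel (hE : T.HasEq) : Str where
  C ρ := Quotient (eqvSetoid hT h₀ hE ρ)
  app := Quotient.map₂ preModel.app fun _ _ hfg _ _ hxy => Eqv.app hE hfg hxy
  zero := Quotient.mk _ preModel.zero
  succ := Quotient.mk _ preModel.succ
  combPi ρ τ := Quotient.mk _ (preModel.combPi ρ τ)
  combSigma ρ σ τ := Quotient.mk _ (preModel.combSigma ρ σ τ)
  recursor := Quotient.mk _ preModel.recursor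

theorem termModel_ext (hE : T.HasEq) : (termModel hT h₀ hE).Ext := by
  intro ρ τ f g h
  induction f, g using Quotient.inductionOn₂ with
  | _ f g => exact Quotient.sound (eqv_arr.2 fun x => Quotient.exact (h (Quotient.mk _ x)))

variable (hT h₀) in
/-- The assignment of equivalence classes of terms. -/
def mkEnv (hE : T.HasEq) (e : preModel.Env Γ) : (termModel hT h₀ hE).Env Γ :=
  fun _ x => Quotient.mk _ (e x)

theorem eval_mkEnv (hE : T.HasEq) (e : preModel.Env Γ) (t : Tm Γ ρ) :
    t.eval (mkEnv hT h₀ hE e) = Quotient.mk _ (t.eval e) := by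
  induction t with
  | app s t ihs iht =>
    rw [Tm.eval_app, ihs, iht]
    rfl
  | _ => rfl

theorem sat_mkEnv_iff_holds (hE : T.HasEq) (A : Fm Γ) (e : preModel.Env Γ) :
    A.Sat (mkEnv hT h₀ hE e) ↔ Holds hT h₀ A e := by
  induction A with
  | eq s t =>
    rw [Fm.sat_eq, eval_mkEnv, eval_mkEnv]
    exact Quotient.eq.trans (holds_eqAt (ρ := .nat)).symm
  | bot => exact iff_of_false id (not_holds_bot e)
  | imp A B ihA ihB => rw [Fm.sat_imp, ihA, ihB, holds_imp_iff]
  | all ρ A ih =>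
    rw [Fm.sat_all, holds_all_iff]
    refine Quotient.forall.trans (forall_congr' fun a => ?_)
    rw [← ih]
    refine iff_of_eq (congrArg A.Sat ?_)
    funext τ x
    cases x <;> rfl

theorem termModel_models (hE : T.HasEq) : (termModel hT h₀ hE).Models T := by
  intro Γ A hA e
  obtain ⟨e, rfl⟩ : ∃ e', mkEnv hT h₀ hE e' = e :=
    ⟨fun _ x => (e x).out, by funext ρ x; exact Quotient.out_eq _⟩
  exact (sat_mkEnv_iff_holds hE A e).2 (holds_of_ax hA e)

theorem sat_of_mem (hE : T.HasEq) {A : Fm []} (hA : A ∈ H₀) :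
    A.Sat (.nil : (termModel hT h₀ hE).Env []) := by
  rw [← Str.Env.eq_nil (mkEnv hT h₀ hE .nil), sat_mkEnv_iff_holds]
  refine holds_of_derAt (N := 0) (fun n h => ?_) ?_
  · funext ρ x
    cases x
  · have hid : stageSub (.nil : preModel.Env []) 0 = Sub.id [] := by
      funext ρ x
      cases x
    have hA' : A.sub (Sub.id []) ∈ H₀ := by rwa [Fm.sub_id]
    rw [hid]
    exact .hyp hA'

end Truth

end Henkin

theorem der_of_forall_sat {T : Theory} (hT : T.SubClosed) (hE : T.HasEq) {H : List (Fm [])}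
    {A : Fm []} (h : ∀ M : Str, M.Ext → M.Models T →
      (∀ B ∈ H, B.Sat (.nil : M.Env [])) → A.Sat (.nil : M.Env [])) : Der T H A := by
  refine .raa (by_contra fun hcon => ?_)
  let M := Henkin.termModel hT hcon hE
  have hH : ∀ B ∈ A.neg :: H, B.Sat (.nil : M.Env []) := fun B => Henkin.sat_of_mem hE
  exact hH A.neg List.mem_cons_self (h M (Henkin.termModel_ext hE) (Henkin.termModel_models hE)
    fun B hB => hH B (List.mem_cons_of_mem _ hB))

theorem Theory.Plus.proves_of_der {T : Theory} {A B : Fm []} (h : Der T [B] A) :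
    (T.Plus B).Proves A :=
  .impE (.impI (h.mono fun _ _ => .old)) (.ax .new)

/-! ### Definability in models -/

/-- Extensional models of `RCA₀^ω`. -/
class Str.IsRCAModel (M : Str) : Prop where
  ext : M.Ext
  rca : M.Models RCA

/-- Extensional models of `RCA₀^ω + (μ)`. -/
class Str.IsMuModel (M : Str) : Prop extends M.IsRCAModel where
  mu : muAxiom.Sat (.nil : M.Env [])

namespace Str

section Axioms

variable {M : Str} [M.IsRCAModel] {Γ : Ctx} {ρ σ τ : Ty}

/-- The number `1`. -/
abbrev one (M : Str) : M.C Ty.nat := M.succ ⋄ M.zero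

theorem app_ext {f g : M.C (ρ ⇾ τ)} (h : ∀ x, f ⋄ x = g ⋄ x) : f = g :=
  IsRCAModel.ext f g h

@[simp] theorem combPi_app (a : M.C ρ) (b : M.C τ) : M.combPi ρ τ ⋄ a ⋄ b = a :=
  (Fm.sat_eqAt IsRCAModel.ext _ _ _).1
    (IsRCAModel.rca _ (RCA.combPi v0 v1) (.cons a (.cons b .nil)))

@[simp] theorem combSigma_app (a : M.C (ρ ⇾ σ ⇾ τ)) (b : M.C (ρ ⇾ σ)) (c : M.C ρ) :
    M.combSigma ρ σ τ ⋄ a ⋄ b ⋄ c = a ⋄ c ⋄ (b ⋄ c) :=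
  (Fm.sat_eqAt IsRCAModel.ext _ _ _).1
    (IsRCAModel.rca _ (RCA.combSigma v0 v1 v2) (.cons a (.cons b (.cons c .nil))))

@[simp] theorem recursor_zero (y : M.C Ty.nat) (z : M.C (Ty.nat ⇾ Ty.nat ⇾ Ty.nat)) :
    M.recursor ⋄ M.zero ⋄ y ⋄ z = y :=
  IsRCAModel.rca _ (RCA.rec_zero v0 v1) (.cons y (.cons z .nil))

@[simp] theorem recursor_succ (x y : M.C Ty.nat) (z : M.C (Ty.nat ⇾ Ty.nat ⇾ Ty.nat)) :
    M.recursor ⋄ (M.succ ⋄ x) ⋄ y ⋄ z = z ⋄ (M.recursor ⋄ x ⋄ y ⋄ z) ⋄ x :=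
  IsRCAModel.rca _ (RCA.rec_succ v0 v1 v2) (.cons x (.cons y (.cons z .nil)))

@[simp] theorem succ_ne_zero (x : M.C Ty.nat) : M.succ ⋄ x ≠ M.zero :=
  IsRCAModel.rca _ (RCA.succ_ne_zero v0) (.cons x .nil)

theorem induction_app (f : M.C Ty.one) (hz : f ⋄ M.zero = M.zero)
    (hs : ∀ x, f ⋄ x = M.zero → f ⋄ (M.succ ⋄ x) = M.zero) (x : M.C Ty.nat) :
    f ⋄ x = M.zero :=
  IsRCAModel.rca _ (RCA.induction (Γ := [Ty.one]) (v1 ⬝ v0 ≐ .zero) trivial) (.cons f .nil)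
    hz hs x

@[simp] theorem eval_lam (t : Tm (ρ :: Γ) τ) (e : M.Env Γ) (a : M.C ρ) :
    t.lam.eval e ⋄ a = t.eval (.cons a e) := by
  induction t with
  | var x => cases x <;> simp [Tm.lam, Tm.eval, Env.cons]
  | app s t ihs iht => simp [Tm.lam, Tm.eval, ← ihs, ← iht]
  | _ => simp [Tm.lam, Tm.eval]

theorem exists_rec (a : M.C Ty.nat) (g : M.C (Ty.nat ⇾ Ty.nat ⇾ Ty.nat)) :
    ∃ f : M.C Ty.one, f ⋄ M.zero = a ∧ ∀ n, f ⋄ (M.succ ⋄ n) = g ⋄ (f ⋄ n) ⋄ n :=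
  ⟨(Tm.lam (.recursor ⬝ v0 ⬝ v1 ⬝ v2)).eval (.cons a (.cons g .nil)), by simp [Tm.eval]⟩

theorem exists_pair : ∃ p : M.C (Ty.nat ⇾ Ty.nat ⇾ Ty.one),
    ∀ a b, p ⋄ a ⋄ b ⋄ M.zero = a ∧ p ⋄ a ⋄ b ⋄ M.one = b :=
  ⟨(Tm.lam (Tm.lam (Tm.lam (.recursor ⬝ v0 ⬝ v2 ⬝ Tm.lam (Tm.lam v3))))).eval .nil,
    by simp [Tm.eval]⟩

open Classical in
/-- The truth value of a proposition, `0` standing for truth as in characteristic functions. -/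
noncomputable def truth (M : Str) (p : Prop) : M.C Ty.nat := if p then M.zero else M.one

@[simp] theorem truth_eq_zero {p : Prop} : M.truth p = M.zero ↔ p := by
  unfold truth
  split_ifs with h <;> simp [h]

theorem truth_eq_zero_or_one (M : Str) (p : Prop) :
    M.truth p = M.zero ∨ M.truth p = M.one := by
  unfold truth
  split_ifs <;> simp

open Classical in
@[simp] theorem recursor_truth (p : Prop) (a b : M.C Ty.nat) :
    M.recursor ⋄ M.truth p ⋄ a ⋄ (M.combPi _ Ty.nat ⋄ (M.combPi _ Ty.nat ⋄ b)) =
      if p then a else b := by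
  unfold truth
  split_ifs <;> simp

theorem exists_eq_decider : ∃ d : M.C Ty.two, ∀ f : M.C Ty.one,
    d ⋄ f = M.truth (f ⋄ M.zero = f ⋄ M.one) := by
  let E : Fm [Ty.nat, Ty.one] := v1 ⬝ .zero ≐ v1 ⬝ .num1
  let A : Fm [Ty.nat, Ty.one] := (E ⇒ v0 ≐ .zero) ⩓ (E.neg ⇒ v0 ≐ .num1)
  have hA : ∀ (f : M.C Ty.one) x, A.Sat (.cons x (.cons f .nil)) ↔
      x = M.truth (f ⋄ M.zero = f ⋄ M.one) := fun f x => by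
    by_cases h : f ⋄ M.zero = f ⋄ M.one <;> simp [A, E, Tm.num1, truth, h]
  have hQF : A.QF := by simp [A, E, Fm.and, Fm.neg, Fm.QF]
  have hchoice := IsRCAModel.rca (M := M) _ (RCA.choice A hQF) .nil
    fun f => (Fm.sat_ex _ _).2 ⟨_, (hA f _).2 rfl⟩
  obtain ⟨d, hd⟩ := (Fm.sat_ex _ _).1 hchoice
  refine ⟨d, fun f => (hA f _).1 ?_⟩
  exact hd f

end Axioms

section Definability

variable {M : Str} {Γ : Ctx} {ρ τ : Ty}

/-- Functions of several variables that are given by terms with parameters. A class, so that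
definability is established by instance search. -/
class inductive Definable {Γ : Ctx} : {τ : Ty} → (M.Env Γ → M.C τ) → Prop
  | const {τ : Ty} (c : M.C τ) : Definable (fun _ => c)
  | var {τ : Ty} (x : Var Γ τ) : Definable (fun e => e x)
  | app {ρ τ : Ty} {f : M.Env Γ → M.C (ρ ⇾ τ)} {g : M.Env Γ → M.C ρ} :
      Definable f → Definable g → Definable (fun e => f e ⋄ g e)

/-- Predicates with a definable characteristic function. -/
class DefinablePred (P : M.Env Γ → Prop) : Prop where
  definable_truth : Definable fun e => M.truth (P e)

instance Definable.instConst (c : M.C τ) : Definable (Γ := Γ) (fun _ => c) := .const c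

instance Definable.instVar (x : Var Γ τ) : Definable (fun e : M.Env Γ => e x) := .var x

instance Definable.instApp (f : M.Env Γ → M.C (ρ ⇾ τ)) (g : M.Env Γ → M.C ρ)
    [hf : Definable f] [hg : Definable g] : Definable (fun e => f e ⋄ g e) := .app hf hg

instance DefinablePred.instTruth (P : M.Env Γ → Prop) [hP : DefinablePred P] :
    Definable fun e => M.truth (P e) := hP.definable_truth

theorem Definable.weaken (σ : Ty) (f : M.Env Γ → M.C τ) [hf : Definable f] :
    Definable (fun e : M.Env (σ :: Γ) => f (fun _ x => e (.s x))) := by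
  induction hf with
  | const c => exact .const c
  | var x => exact .var x.s
  | app _ _ ihf ihg => exact .app ihf ihg

theorem DefinablePred.congr {P Q : M.Env Γ → Prop} (hP : DefinablePred P)
    (h : ∀ e, Q e ↔ P e) : DefinablePred Q := by
  rwa [funext fun e => propext (h e)]

section RCAModel

variable [M.IsRCAModel]

theorem Definable.exists_lam {f : M.Env (ρ :: Γ) → M.C τ} (hf : Definable f) :
    ∃ g : M.Env Γ → M.C (ρ ⇾ τ), Definable g ∧ ∀ e a, g e ⋄ a = f (.cons a e) := by
  induction hf with
  | const c => exact ⟨fun _ => M.combPi _ _ ⋄ c, inferInstance, fun _ a => combPi_app c a⟩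
  | var x =>
    cases x with
    | z => exact ⟨fun _ => (Tm.lam v0).eval .nil, inferInstance, fun _ a => eval_lam v0 .nil a⟩
    | s x => exact ⟨fun e => M.combPi _ _ ⋄ e x, inferInstance, fun e a => combPi_app (e x) a⟩
  | app _ _ ihf ihg =>
    obtain ⟨f', hf', hf''⟩ := ihf
    obtain ⟨g', hg', hg''⟩ := ihg
    exact ⟨fun e => M.combSigma _ _ _ ⋄ f' e ⋄ g' e, inferInstance,
      fun e a => by rw [combSigma_app, hf'', hg'']⟩

instance DefinablePred.eq (f g : M.Env Γ → M.C Ty.nat) [Definable f] [Definable g] :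
    DefinablePred fun e => f e = g e := by
  obtain ⟨d, hd⟩ := exists_eq_decider (M := M)
  obtain ⟨p, hp⟩ := exists_pair (M := M)
  have htruth (e : M.Env Γ) : M.truth (f e = g e) = d ⋄ (p ⋄ f e ⋄ g e) := by
    rw [hd, (hp _ _).1, (hp _ _).2]
  exact ⟨by simp only [htruth]; infer_instance⟩

instance DefinablePred.not (P : M.Env Γ → Prop) [DefinablePred P] :
    DefinablePred fun e => ¬ P e :=
  .congr (inferInstance : DefinablePred fun e => M.truth (P e) = M.one) fun e => by
    by_cases h : P e <;> simp [truth, h, (succ_ne_zero _).symm]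

instance DefinablePred.and (P Q : M.Env Γ → Prop) [DefinablePred P] [DefinablePred Q] :
    DefinablePred fun e => P e ∧ Q e :=
  .congr (inferInstance : DefinablePred fun e => M.recursor ⋄ M.truth (P e) ⋄ M.truth (Q e) ⋄
    (M.combPi _ Ty.nat ⋄ (M.combPi _ Ty.nat ⋄ M.one)) = M.zero) fun e => by
    by_cases h : P e <;> simp [h]

instance DefinablePred.or (P Q : M.Env Γ → Prop) [DefinablePred P] [DefinablePred Q] :
    DefinablePred fun e => P e ∨ Q e :=
  .congr (inferInstance : DefinablePred fun e => ¬ (¬ P e ∧ ¬ Q e)) fun e => by tauto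

instance DefinablePred.imp (P Q : M.Env Γ → Prop) [DefinablePred P] [DefinablePred Q] :
    DefinablePred fun e => P e → Q e :=
  .congr (inferInstance : DefinablePred fun e => ¬ (P e ∧ ¬ Q e)) fun e => by tauto

instance DefinablePred.iff (P Q : M.Env Γ → Prop) [DefinablePred P] [DefinablePred Q] :
    DefinablePred fun e => P e ↔ Q e :=
  .congr (inferInstance : DefinablePred fun e => (P e → Q e) ∧ (Q e → P e)) fun e => by tauto

theorem exists_char (P : M.C ρ → Prop) [hP : DefinablePred fun e : M.Env [ρ] => P (e .z)] :
    ∃ t : M.C (ρ ⇾ Ty.nat), ∀ x, t ⋄ x = M.truth (P x) := by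
  obtain ⟨g, -, hg⟩ := hP.definable_truth.exists_lam
  exact ⟨g .nil, hg .nil⟩

theorem induction (P : M.C Ty.nat → Prop) [DefinablePred fun e : M.Env [Ty.nat] => P (e .z)]
    (hz : P M.zero) (hs : ∀ x, P x → P (M.succ ⋄ x)) (x : M.C Ty.nat) : P x := by
  obtain ⟨t, ht⟩ := exists_char P
  have ht₀ (x : M.C Ty.nat) : t ⋄ x = M.zero ↔ P x := by rw [ht, truth_eq_zero]
  exact (ht₀ x).1 (induction_app t ((ht₀ _).2 hz)
    (fun y hy => (ht₀ _).2 (hs y ((ht₀ y).1 hy))) x)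

end RCAModel

section MuModel

variable [M.IsMuModel]

theorem exists_mu : ∃ m : M.C Ty.two, ∀ f : M.C Ty.one,
    (∃ x, f ⋄ x = M.zero) → f ⋄ (m ⋄ f) = M.zero := by
  simpa [muAxiom] using IsMuModel.mu (M := M)

theorem DefinablePred.exists_select {P : M.Env (Ty.nat :: Γ) → Prop} (hP : DefinablePred P) :
    ∃ s : M.Env Γ → M.C Ty.nat, Definable s ∧
      ∀ e, (∃ a, P (.cons a e)) → P (.cons (s e) e) := by
  obtain ⟨m, hm⟩ := exists_mu (M := M)
  obtain ⟨g, _, hg⟩ := hP.definable_truth.exists_lam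
  have hgP (e : M.Env Γ) (a : M.C Ty.nat) : g e ⋄ a = M.zero ↔ P (.cons a e) := by
    rw [hg, truth_eq_zero]
  exact ⟨fun e => m ⋄ g e, inferInstance, fun e ⟨a, ha⟩ =>
    (hgP e _).1 (hm _ ⟨a, (hgP e a).2 ha⟩)⟩

instance DefinablePred.ex (Q : M.Env Γ → M.C Ty.nat → Prop)
    [hQ : DefinablePred fun e : M.Env (Ty.nat :: Γ) => Q (fun _ x => e (.s x)) (e .z)] :
    DefinablePred fun e => ∃ a, Q e a := by
  obtain ⟨s, hs, hsQ⟩ := hQ.exists_select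
  obtain ⟨g, _, hg⟩ := hQ.definable_truth.exists_lam
  refine .congr (inferInstance : DefinablePred fun e => g e ⋄ s e = M.zero) fun e => ?_
  rw [hg, truth_eq_zero]
  exact ⟨hsQ e, fun h => ⟨_, h⟩⟩

instance DefinablePred.all (Q : M.Env Γ → M.C Ty.nat → Prop)
    [DefinablePred fun e : M.Env (Ty.nat :: Γ) => Q (fun _ x => e (.s x)) (e .z)] :
    DefinablePred fun e => ∀ a, Q e a :=
  .congr (inferInstance : DefinablePred fun e => ¬ ∃ a, ¬ Q e a) fun e => by simp

theorem exists_choice (S : M.C Ty.nat → M.C Ty.nat → M.C Ty.nat → Prop)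
    [hS : DefinablePred fun e : M.Env [Ty.nat, Ty.nat, Ty.nat] =>
      S (e (.s (.s .z))) (e (.s .z)) (e .z)] :
    ∃ g : M.C (Ty.nat ⇾ Ty.nat ⇾ Ty.nat), ∀ a b, (∃ c, S a b c) → S a b (g ⋄ a ⋄ b) := by
  obtain ⟨s, hs, hsS⟩ := hS.exists_select
  obtain ⟨g₁, hg₁, hg₁s⟩ := hs.exists_lam
  obtain ⟨g₂, -, hg₂⟩ := hg₁.exists_lam
  exact ⟨g₂ .nil, fun a b h => by
    rw [hg₂, hg₁s]
    exact hsS (.cons b (.cons a .nil)) h⟩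

theorem exists_dependent_choice (R : M.C Ty.nat → M.C Ty.nat → M.C Ty.nat → Prop)
    [DefinablePred fun e : M.Env [Ty.nat, Ty.nat, Ty.nat] =>
      R (e (.s .z)) (e (.s (.s .z))) (e .z)] (a : M.C Ty.nat) :
    ∃ c : M.C Ty.one, c ⋄ M.zero = a ∧
      ∀ n, (∃ x, R n (c ⋄ n) x) → R n (c ⋄ n) (c ⋄ (M.succ ⋄ n)) := by
  obtain ⟨g, hg⟩ := exists_choice fun x n y => R n x y
  obtain ⟨c, hc₀, hc⟩ := exists_rec a g
  exact ⟨c, hc₀, fun n h => by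
    rw [hc]
    exact hg _ _ h⟩

end MuModel

end Definability

end Str

/-! ### Arithmetic and sets in models -/

namespace Str

section Arithmetic

variable {M : Str} {Γ : Ctx}

/-- The step function of the predecessor, viewed as a primitive recursion. -/
def predStep (M : Str) : M.C (Ty.nat ⇾ Ty.nat ⇾ Ty.nat) := (Tm.lam (Tm.lam v0)).eval .nil

/-- The predecessor, with `pred 0 = 0`. -/
def pred (x : M.C Ty.nat) : M.C Ty.nat := M.recursor ⋄ x ⋄ M.zero ⋄ M.predStep

/-- The step function of truncated subtraction. -/
def monusStep (M : Str) : M.C (Ty.nat ⇾ Ty.nat ⇾ Ty.nat) :=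
  (Tm.lam (Tm.lam (Tm.pred v1))).eval .nil

/-- Truncated subtraction. -/
def monus (x y : M.C Ty.nat) : M.C Ty.nat := M.recursor ⋄ y ⋄ x ⋄ M.monusStep

/-- The step function of addition. -/
def addStep (M : Str) : M.C (Ty.nat ⇾ Ty.nat ⇾ Ty.nat) :=
  (Tm.lam (Tm.lam (.succ ⬝ v1))).eval .nil

/-- Addition. -/
def add (x y : M.C Ty.nat) : M.C Ty.nat := M.recursor ⋄ y ⋄ x ⋄ M.addStep

/-- The strict order, defined from truncated subtraction as in `Fm.lt`. -/
def Lt (x y : M.C Ty.nat) : Prop := monus (M.succ ⋄ x) y = M.zero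

section RCAModel

variable [M.IsRCAModel]

theorem eval_pred (s : Tm Γ Ty.nat) (e : M.Env Γ) : s.pred.eval e = pred (s.eval e) := by
  have hstep : (Tm.lam (Tm.lam v0) : Tm Γ (Ty.nat ⇾ Ty.nat ⇾ Ty.nat)).eval e = M.predStep :=
    app_ext fun x => app_ext fun y => by simp [predStep]
  simp [Tm.pred, pred, ← hstep, Tm.eval]

@[simp] theorem pred_zero : pred M.zero = M.zero := by simp [pred]

@[simp] theorem pred_succ (x : M.C Ty.nat) : pred (M.succ ⋄ x) = x := by simp [pred, predStep]

theorem eval_monus (s t : Tm Γ Ty.nat) (e : M.Env Γ) :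
    (s.monus t).eval e = monus (s.eval e) (t.eval e) := by
  have hstep : (Tm.lam (Tm.lam (Tm.pred v1)) : Tm Γ (Ty.nat ⇾ Ty.nat ⇾ Ty.nat)).eval e =
      M.monusStep :=
    app_ext fun x => app_ext fun y => by simp [monusStep, eval_pred]
  simp [Tm.monus, monus, ← hstep, Tm.eval]

@[simp] theorem monus_zero (x : M.C Ty.nat) : monus x M.zero = x := by simp [monus]

theorem monus_succ (x y : M.C Ty.nat) : monus x (M.succ ⋄ y) = pred (monus x y) := by
  simp [monus, monusStep, eval_pred]

theorem eval_add (s t : Tm Γ Ty.nat) (e : M.Env Γ) :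
    (s.add t).eval e = add (s.eval e) (t.eval e) := by
  have hstep : (Tm.lam (Tm.lam (.succ ⬝ v1)) : Tm Γ (Ty.nat ⇾ Ty.nat ⇾ Ty.nat)).eval e =
      M.addStep :=
    app_ext fun x => app_ext fun y => by simp [addStep]
  simp [Tm.add, add, ← hstep, Tm.eval]

@[simp] theorem add_zero (x : M.C Ty.nat) : add x M.zero = x := by simp [add]

@[simp] theorem add_succ (x y : M.C Ty.nat) : add x (M.succ ⋄ y) = M.succ ⋄ add x y := by
  simp [add, addStep]

theorem eq_zero_or_succ (x : M.C Ty.nat) : x = M.zero ∨ ∃ y, x = M.succ ⋄ y := by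
  have hpred : x = M.zero ∨ x = M.succ ⋄ pred x := by
    unfold pred
    exact induction (fun x => x = M.zero ∨ x = M.succ ⋄ (M.recursor ⋄ x ⋄ M.zero ⋄ M.predStep))
      (.inl rfl) (fun x _ => .inr (congrArg _ (pred_succ x).symm)) x
  exact hpred.imp_right fun h => ⟨_, h⟩

theorem add_eq_zero {x y : M.C Ty.nat} : add x y = M.zero ↔ x = M.zero ∧ y = M.zero := by
  rcases eq_zero_or_succ y with rfl | ⟨y, rfl⟩ <;> simp

instance Definable.monus (f g : M.Env Γ → M.C Ty.nat) [Definable f] [Definable g] :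
    Definable fun e => monus (f e) (g e) := by
  unfold Str.monus
  infer_instance

instance Definable.add (f g : M.Env Γ → M.C Ty.nat) [Definable f] [Definable g] :
    Definable fun e => add (f e) (g e) := by
  unfold Str.add
  infer_instance

@[simp] theorem succ_monus_succ (x y : M.C Ty.nat) :
    monus (M.succ ⋄ x) (M.succ ⋄ y) = monus x y :=
  induction (fun y => monus (M.succ ⋄ x) (M.succ ⋄ y) = monus x y) (by simp [monus_succ])
    (fun y hy => by rw [monus_succ, hy, monus_succ]) y

@[simp] theorem zero_monus (x : M.C Ty.nat) : monus M.zero x = M.zero :=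
  induction (fun x => monus M.zero x = M.zero) (by simp)
    (fun x hx => by rw [monus_succ, hx, pred_zero]) x

@[simp] theorem monus_self (x : M.C Ty.nat) : monus x x = M.zero :=
  induction (fun x => monus x x = M.zero) (by simp) (fun x hx => by rw [succ_monus_succ, hx]) x

@[simp] theorem succ_monus_self (x : M.C Ty.nat) : monus (M.succ ⋄ x) x = M.one :=
  induction (fun x => monus (M.succ ⋄ x) x = M.one) (by simp)
    (fun x hx => by rw [succ_monus_succ, hx]) x

instance DefinablePred.lt (f g : M.Env Γ → M.C Ty.nat) [Definable f] [Definable g] :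
    DefinablePred fun e => Lt (f e) (g e) := by
  unfold Lt
  infer_instance

theorem sat_lt (s t : Tm Γ Ty.nat) (e : M.Env Γ) :
    (Fm.lt s t).Sat e ↔ Lt (s.eval e) (t.eval e) := by
  simp [Fm.lt, eval_monus, Lt]

theorem not_lt_zero (x : M.C Ty.nat) : ¬ Lt x M.zero := by simp [Lt]

theorem zero_lt_succ (x : M.C Ty.nat) : Lt M.zero (M.succ ⋄ x) := by simp [Lt]

theorem lt_succ_self (x : M.C Ty.nat) : Lt x (M.succ ⋄ x) := by simp [Lt]

theorem succ_lt_succ {x y : M.C Ty.nat} : Lt (M.succ ⋄ x) (M.succ ⋄ y) ↔ Lt x y := by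
  simp [Lt]

theorem lt_succ_of_lt {x y : M.C Ty.nat} (h : Lt x y) : Lt x (M.succ ⋄ y) := by
  unfold Lt at h ⊢
  rw [monus_succ, h, pred_zero]

theorem exists_lt_and_lt (x y : M.C Ty.nat) : ∃ m, Lt x m ∧ Lt y m := by
  refine ⟨M.succ ⋄ add x y, ?_, ?_⟩
  · exact induction (fun y => Lt x (M.succ ⋄ add x y)) (by simp [lt_succ_self])
      (fun y hy => by rw [add_succ]; exact lt_succ_of_lt hy) y
  · exact induction (fun y => Lt y (M.succ ⋄ add x y)) (zero_lt_succ _)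
      (fun y hy => by rw [add_succ]; exact succ_lt_succ.2 hy) y

end RCAModel

section MuModel

variable [M.IsMuModel]

theorem lt_succ_iff {x y : M.C Ty.nat} : Lt x (M.succ ⋄ y) ↔ Lt x y ∨ x = y := by
  refine ⟨?_, fun h => h.elim lt_succ_of_lt fun h => h ▸ lt_succ_self x⟩
  refine induction (fun y => ∀ x, Lt x (M.succ ⋄ y) → Lt x y ∨ x = y) (fun x hx => ?_)
    (fun y ih x hx => ?_) y x
  · rcases eq_zero_or_succ x with rfl | ⟨x, rfl⟩
    · exact .inr rfl
    · exact (not_lt_zero x (succ_lt_succ.1 hx)).elim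
  · rcases eq_zero_or_succ x with rfl | ⟨x, rfl⟩
    · exact .inl (zero_lt_succ y)
    · exact (ih x (succ_lt_succ.1 hx)).imp succ_lt_succ.2 (congrArg _)

theorem lt_trans {x y z : M.C Ty.nat} (hxy : Lt x y) (hyz : Lt y z) : Lt x z := by
  refine induction (fun z => ∀ y, Lt x y → Lt y z → Lt x z) (fun y _ h => ?_)
    (fun z ih y hxy hyz => ?_) z y hxy hyz
  · exact (not_lt_zero y h).elim
  · rcases lt_succ_iff.1 hyz with h | rfl
    · exact lt_succ_of_lt (ih y hxy h)
    · exact lt_succ_of_lt hxy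

end MuModel

end Arithmetic

section Sets

variable {M : Str} {Γ : Ctx}

/-- Membership in the set with characteristic function `X`. -/
def Elt (n : M.C Ty.nat) (X : M.C Ty.one) : Prop := X ⋄ n = M.zero

/-- Extensional equality of sets, that is, of the supports of their characteristic functions. -/
def SetEq (X Y : M.C Ty.one) : Prop := ∀ n, Elt n X ↔ Elt n Y

/-- Unboundedness, in the sense of the order of the structure. -/
def Infinite (X : M.C Ty.one) : Prop := ∀ n, ∃ k, Lt n k ∧ Elt k X

/-- Membership, up to `SetEq`, in the range of the sequence `A` of sets. -/
def MemSeq (A : M.C Ty.seq) (X : M.C Ty.one) : Prop := ∃ i, SetEq X (A ⋄ i)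

/-- The intersection of two sets. -/
def inter (X Y : M.C Ty.one) : M.C Ty.one := (Tm.inter v0 v1).eval (.cons X (.cons Y .nil))

/-- The union of two sets. -/
def union (X Y : M.C Ty.one) : M.C Ty.one := (Tm.union v0 v1).eval (.cons X (.cons Y .nil))

/-- The complement of a set. -/
def compl (X : M.C Ty.one) : M.C Ty.one := (Tm.compl v0).eval (.cons X .nil)

/-- The `0`/`1`-valued characteristic function of a set. -/
def normalize (X : M.C Ty.one) : M.C Ty.one := (Tm.normalize v0).eval (.cons X .nil)

theorem SetEq.refl (X : M.C Ty.one) : SetEq X X := fun _ => Iff.rfl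

theorem memSeq_apply (A : M.C Ty.seq) (i : M.C Ty.nat) : MemSeq A (A ⋄ i) := ⟨i, .refl _⟩

section RCAModel

variable [M.IsRCAModel]

theorem eval_inter (X Y : Tm Γ Ty.one) (e : M.Env Γ) :
    (X.inter Y).eval e = inter (X.eval e) (Y.eval e) :=
  app_ext fun x => by simp [inter, Tm.inter, Tm.max, eval_add, eval_monus]

theorem eval_union (X Y : Tm Γ Ty.one) (e : M.Env Γ) :
    (X.union Y).eval e = union (X.eval e) (Y.eval e) :=
  app_ext fun x => by simp [union, Tm.union, Tm.min, eval_monus]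

theorem eval_compl (X : Tm Γ Ty.one) (e : M.Env Γ) : X.compl.eval e = compl (X.eval e) :=
  app_ext fun x => by simp [compl, Tm.compl, Tm.num1, eval_monus]

theorem eval_normalize (X : Tm Γ Ty.one) (e : M.Env Γ) :
    X.normalize.eval e = normalize (X.eval e) :=
  app_ext fun x => by simp [normalize, Tm.normalize, Tm.min, Tm.num1, eval_monus]

@[simp] theorem elt_inter {n : M.C Ty.nat} {X Y : M.C Ty.one} :
    Elt n (inter X Y) ↔ Elt n X ∧ Elt n Y := by
  simp only [Elt, inter, Tm.inter, Tm.max, eval_lam, eval_add, eval_monus, Tm.eval_app,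
    Tm.eval_up, eval_v0, eval_v1, add_eq_zero]
  exact and_congr_right fun h => by rw [h, monus_zero]

@[simp] theorem elt_compl {n : M.C Ty.nat} {X : M.C Ty.one} :
    Elt n (compl X) ↔ ¬ Elt n X := by
  simp only [Elt, compl, Tm.compl, Tm.num1, eval_lam, eval_monus, Tm.eval_app, Tm.eval_succ,
    Tm.eval_zero, Tm.eval_up, eval_v0]
  rcases eq_zero_or_succ (X ⋄ n) with h | ⟨x, h⟩ <;> rw [h] <;> simp

@[simp] theorem elt_normalize {n : M.C Ty.nat} {X : M.C Ty.one} :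
    Elt n (normalize X) ↔ Elt n X := by
  simp only [Elt, normalize, Tm.normalize, Tm.min, Tm.num1, eval_lam, eval_monus, Tm.eval_app,
    Tm.eval_succ, Tm.eval_zero, Tm.eval_up, eval_v0]
  rcases eq_zero_or_succ (X ⋄ n) with h | ⟨x, h⟩ <;> rw [h] <;> simp

instance DefinablePred.elt (f : M.Env Γ → M.C Ty.nat) (g : M.Env Γ → M.C Ty.one)
    [Definable f] [Definable g] : DefinablePred fun e => Elt (f e) (g e) := by
  unfold Elt
  infer_instance

end RCAModel

section MuModel

variable [M.IsMuModel]

instance DefinablePred.setEq (f g : M.Env Γ → M.C Ty.one) [Definable f] [Definable g] :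
    DefinablePred fun e => SetEq (f e) (g e) := by
  have := Definable.weaken Ty.nat f
  have := Definable.weaken Ty.nat g
  unfold SetEq
  infer_instance

instance DefinablePred.memSeq (f : M.Env Γ → M.C Ty.seq) (g : M.Env Γ → M.C Ty.one)
    [Definable f] [Definable g] : DefinablePred fun e => MemSeq (f e) (g e) := by
  have := Definable.weaken Ty.nat f
  have := Definable.weaken Ty.nat g
  unfold MemSeq
  infer_instance

end MuModel

end Sets

end Str

/-! ### Branches and ultrafilters -/

namespace Str

section Branches

variable {M : Str} {B F : M.C Ty.seq} {b : M.C Ty.one}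

/-- The numbers `w` and `z` belong to the same sets among the `B_i` with `i < n`. -/
abbrev Agree (B : M.C Ty.seq) (n w z : M.C Ty.nat) : Prop :=
  ∀ i, Lt i n → (Elt z (B ⋄ i) ↔ Elt w (B ⋄ i))

/-- The `0`/`1`-sequence of length `n` recording to which `B_i` the number `w` belongs is a node of
the tree. Every node is of this form, so that numbers can serve as codes for nodes. -/
abbrev Node (B F : M.C Ty.seq) (n w : M.C Ty.nat) : Prop :=
  ∀ j y, ∃ z, Lt y z ∧ Elt z (F ⋄ j) ∧ Agree B n w z

/-- The sets `F_j` are infinite and downward directed. -/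
structure IsFilterBase (F : M.C Ty.seq) : Prop where
  directed (i j : M.C Ty.nat) : ∃ k, ∀ n, Elt n (F ⋄ k) → Elt n (F ⋄ i) ∧ Elt n (F ⋄ j)
  infinite (j : M.C Ty.nat) : Infinite (F ⋄ j)

/-- The semantic counterpart of `Fm.branch`. -/
structure IsBranch (B F : M.C Ty.seq) (b : M.C Ty.one) : Prop where
  zero_or_one (i : M.C Ty.nat) : b ⋄ i = M.zero ∨ b ⋄ i = M.one
  realized (n j y : M.C Ty.nat) :
    ∃ z, Lt y z ∧ Elt z (F ⋄ j) ∧ ∀ i, Lt i n → (Elt z (B ⋄ i) ↔ b ⋄ i = M.zero)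

/-- The collection `{F_j | j ∈ ℕ} ∪ {B_i | b i = 0}` of `Fm.generated`. -/
abbrev Generated (B F : M.C Ty.seq) (b X : M.C Ty.one) : Prop :=
  MemSeq F X ∨ ∃ i, b ⋄ i = M.zero ∧ SetEq X (B ⋄ i)

theorem generated_normalize [M.IsRCAModel] (X : M.C Ty.one) :
    Generated B F b (normalize X) ↔ Generated B F b X := by
  simp only [Generated, MemSeq, SetEq, elt_normalize]

theorem Node.zero [M.IsRCAModel] (hF : IsFilterBase F) (w : M.C Ty.nat) :
    Node B F M.zero w := fun j y => by
  obtain ⟨z, hyz, hz⟩ := hF.infinite j y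
  exact ⟨z, hyz, hz, fun i hi => (not_lt_zero i hi).elim⟩

section MuModel

variable [M.IsMuModel]

theorem Node.exists_extension (hF : IsFilterBase F) {n w : M.C Ty.nat} (hw : Node B F n w) :
    ∃ p : Prop, ∀ j y, ∃ z, Lt y z ∧ Elt z (F ⋄ j) ∧ Agree B n w z ∧ (Elt z (B ⋄ n) ↔ p) := by
  by_contra! hp
  obtain ⟨j₁, y₁, h₁⟩ := hp True
  obtain ⟨j₂, y₂, h₂⟩ := hp False
  obtain ⟨k, hk⟩ := hF.directed j₁ j₂
  obtain ⟨m, hm₁, hm₂⟩ := exists_lt_and_lt y₁ y₂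
  obtain ⟨z, hmz, hzk, hwz⟩ := hw k m
  have hz₁ := h₁ z (lt_trans hm₁ hmz) (hk z hzk).1 hwz
  have hz₂ := h₂ z (lt_trans hm₂ hmz) (hk z hzk).2 hwz
  tauto

theorem Node.exists_succ (hF : IsFilterBase F) {n w : M.C Ty.nat} (hw : Node B F n w) :
    ∃ w', Agree B n w w' ∧ Node B F (M.succ ⋄ n) w' := by
  obtain ⟨p, hp⟩ := hw.exists_extension hF
  obtain ⟨w', -, -, hww', hw'⟩ := hp M.zero M.zero
  refine ⟨w', hww', fun j y => ?_⟩
  obtain ⟨z, hyz, hzj, hwz, hz⟩ := hp j y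
  refine ⟨z, hyz, hzj, fun i hi => ?_⟩
  rcases lt_succ_iff.1 hi with hi | rfl
  · exact (hwz i hi).trans (hww' i hi).symm
  · exact hz.trans hw'.symm

theorem exists_path (B : M.C Ty.seq) (hF : IsFilterBase F) : ∃ c : M.C Ty.one, ∀ n,
    Node B F n (c ⋄ n) ∧ Agree B n (c ⋄ n) (c ⋄ (M.succ ⋄ n)) := by
  obtain ⟨c, -, hc⟩ := exists_dependent_choice (M := M)
    (fun n w w' => Agree B n w w' ∧ Node B F (M.succ ⋄ n) w') M.zero
  have hnode : ∀ n, Node B F n (c ⋄ n) := induction _ (Node.zero hF _) fun n hn =>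
    (hc n (hn.exists_succ hF)).2
  exact ⟨c, fun n => ⟨hnode n, (hc n ((hnode n).exists_succ hF)).1⟩⟩

theorem elt_path_iff {c : M.C Ty.one} (hc : ∀ n, Agree B n (c ⋄ n) (c ⋄ (M.succ ⋄ n)))
    (n i : M.C Ty.nat) (hi : Lt i n) :
    Elt (c ⋄ n) (B ⋄ i) ↔ Elt (c ⋄ (M.succ ⋄ i)) (B ⋄ i) := by
  refine induction (fun n => ∀ i, Lt i n →
    (Elt (c ⋄ n) (B ⋄ i) ↔ Elt (c ⋄ (M.succ ⋄ i)) (B ⋄ i))) (fun i hi => ?_)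
    (fun n ih i hi => ?_) n i hi
  · exact (not_lt_zero i hi).elim
  · rcases lt_succ_iff.1 hi with hi | rfl
    · exact (hc n i hi).trans (ih i hi)
    · rfl

theorem exists_isBranch (B : M.C Ty.seq) (hF : IsFilterBase F) : ∃ b, IsBranch B F b := by
  obtain ⟨c, hc⟩ := exists_path B hF
  obtain ⟨b, hb⟩ := exists_char fun i => Elt (c ⋄ (M.succ ⋄ i)) (B ⋄ i)
  refine ⟨b, fun i => hb i ▸ truth_eq_zero_or_one M _, fun n j y => ?_⟩
  obtain ⟨z, hyz, hzj, hz⟩ := (hc n).1 j y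
  refine ⟨z, hyz, hzj, fun i hi => ?_⟩
  rw [hz i hi, hb, truth_eq_zero, elt_path_iff (fun n => (hc n).2) n i hi]

theorem IsBranch.exists_realizer (hb : IsBranch B F b) (i k l j y : M.C Ty.nat) :
    ∃ z, Lt y z ∧ Elt z (F ⋄ j) ∧ (Elt z (B ⋄ i) ↔ b ⋄ i = M.zero) ∧
      (Elt z (B ⋄ k) ↔ b ⋄ k = M.zero) ∧ (Elt z (B ⋄ l) ↔ b ⋄ l = M.zero) := by
  obtain ⟨m, him, hkm⟩ := exists_lt_and_lt i k
  obtain ⟨n, hmn, hln⟩ := exists_lt_and_lt m l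
  obtain ⟨z, hyz, hzj, hz⟩ := hb.realized n j y
  exact ⟨z, hyz, hzj, hz i (lt_trans him hmn), hz k (lt_trans hkm hmn), hz l hln⟩

theorem IsBranch.generated_iff (hb : IsBranch B F b) {X : M.C Ty.one} {i : M.C Ty.nat}
    (hX : SetEq X (B ⋄ i)) : Generated B F b X ↔ b ⋄ i = M.zero := by
  refine ⟨?_, fun hi => .inr ⟨i, hi, hX⟩⟩
  rintro (⟨j, hXj⟩ | ⟨k, hk, hXk⟩)
  · obtain ⟨z, -, hzj, hzi, -⟩ := hb.exists_realizer i i i j M.zero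
    exact hzi.1 ((hX z).1 ((hXj z).2 hzj))
  · obtain ⟨z, -, -, hzi, hzk, -⟩ := hb.exists_realizer i k k M.zero M.zero
    exact hzi.1 ((hX z).1 ((hXk z).2 (hzk.2 hk)))

theorem IsBranch.exists_elt_iff_generated (hb : IsBranch B F b) {X Y Z : M.C Ty.one}
    (hX : MemSeq B X) (hY : MemSeq B Y) (hZ : MemSeq B Z) (y : M.C Ty.nat) :
    ∃ z, Lt y z ∧ (Elt z X ↔ Generated B F b X) ∧ (Elt z Y ↔ Generated B F b Y) ∧
      (Elt z Z ↔ Generated B F b Z) := by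
  obtain ⟨⟨i, hi⟩, ⟨k, hk⟩, ⟨l, hl⟩⟩ := And.intro hX (And.intro hY hZ)
  obtain ⟨z, hyz, -, hzi, hzk, hzl⟩ := hb.exists_realizer i k l M.zero y
  rw [hb.generated_iff hi, hb.generated_iff hk, hb.generated_iff hl]
  exact ⟨z, hyz, (hi z).trans hzi, (hk z).trans hzk, (hl z).trans hzl⟩

end MuModel

end Branches

section Ultrafilters

variable {M : Str} {B F : M.C Ty.seq} {b : M.C Ty.one}

/-- The semantic counterpart of `Fm.algebra`. -/
structure IsAlgebra (C : M.C Ty.one → Prop) : Prop where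
  compl (X : M.C Ty.one) : C X → C (compl X)
  union (X Y : M.C Ty.one) : C X ∧ C Y → C (union X Y)
  inter (X Y : M.C Ty.one) : C X ∧ C Y → C (inter X Y)

/-- The semantic counterpart of `Fm.partialUltrafilter`, except for the clause
`Fm.wellDefined`. -/
structure IsPartialUltrafilter (C U : M.C Ty.one → Prop) : Prop where
  subset (X : M.C Ty.one) : U X → C X
  mem_or_compl_mem (X : M.C Ty.one) : C X → U X ∨ U (compl X)
  mem_of_inter_mem (X Y : M.C Ty.one) : C X ∧ C Y → U (inter X Y) → U Y
  inter_mem (X Y : M.C Ty.one) : C X ∧ C Y → U X ∧ U Y → U (inter X Y)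
  infinite (X : M.C Ty.one) : C X → U X → Infinite X

/-- The algebra enumerated by `B` has a partial non-principal ultrafilter that extends the
collection enumerated by `F` and arises from a branch. -/
def HasUltrafilterExtension (B F : M.C Ty.seq) : Prop :=
  ∃ (b : M.C Ty.one) (U : M.C Ty.two),
    (IsPartialUltrafilter (MemSeq B) (fun X => U ⋄ X = M.zero) ∧
      ∀ X, U ⋄ X = U ⋄ normalize X) ∧
    (∀ X, MemSeq F X → U ⋄ X = M.zero) ∧
    IsBranch B F b ∧
    ∀ X, U ⋄ X = M.zero ↔ Generated B F b X

variable [M.IsMuModel]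

theorem IsBranch.isPartialUltrafilter (hb : IsBranch B F b) (hB : IsAlgebra (MemSeq B))
    (hFB : ∀ X, MemSeq F X → MemSeq B X) :
    IsPartialUltrafilter (MemSeq B) (Generated B F b) where
  subset X := by
    rintro (hX | ⟨i, -, hX⟩)
    exacts [hFB X hX, ⟨i, hX⟩]
  mem_or_compl_mem X hX := by
    obtain ⟨z, -, hzX, hzc, -⟩ := hb.exists_elt_iff_generated hX (hB.compl X hX) hX M.zero
    rw [← hzX, ← hzc, elt_compl]
    exact em _
  mem_of_inter_mem X Y hXY h := by
    obtain ⟨z, -, hzY, hzi, -⟩ := hb.exists_elt_iff_generated hXY.2 (hB.inter X Y hXY) hXY.2 M.zero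
    exact hzY.1 (elt_inter.1 (hzi.2 h)).2
  inter_mem X Y hXY h := by
    obtain ⟨z, -, hzX, hzY, hzi⟩ :=
      hb.exists_elt_iff_generated hXY.1 hXY.2 (hB.inter X Y hXY) M.zero
    exact hzi.1 (elt_inter.2 ⟨hzX.2 h.1, hzY.2 h.2⟩)
  infinite X hX h y := by
    obtain ⟨z, hyz, hzX, -⟩ := hb.exists_elt_iff_generated hX hX hX y
    exact ⟨z, hyz, hzX.2 h⟩

theorem hasUltrafilterExtension (hB : IsAlgebra (MemSeq B))
    (hFB : ∀ X, MemSeq F X → MemSeq B X) (hF : IsFilterBase F) :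
    HasUltrafilterExtension B F := by
  obtain ⟨b, hb⟩ := exists_isBranch B hF
  obtain ⟨U, hU⟩ := exists_char (Generated B F b)
  have hUb : ∀ X, U ⋄ X = M.zero ↔ Generated B F b X := fun X => by
    rw [hU, truth_eq_zero]
  refine ⟨b, U, ⟨?_, fun X => ?_⟩, fun X hX => (hUb X).2 (.inl hX), hb, hUb⟩
  · simpa only [hUb] using hb.isPartialUltrafilter hB hFB
  · rw [hU, hU]
    exact congrArg M.truth (propext (generated_normalize X).symm)

end Ultrafilters

end Str

/-! ### Satisfaction of the formulas about ultrafilters -/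

section Sentences

variable {M : Str} {Γ : Ctx}

/-- The sets that belong to the collection denoted by `C` under an assignment. -/
def Coll.interp (e : M.Env Γ) : Coll Γ → M.C Ty.one → Prop
  | .enum A => Str.MemSeq (A.eval e)
  | .char U => fun X => U.eval e ⋄ X = M.zero

@[simp] theorem Coll.interp_up {σ : Ty} (a : M.C σ) (e : M.Env Γ) (C : Coll Γ) :
    C.up.interp (.cons a e) = C.interp e := by
  cases C <;> simp only [Coll.up, Coll.interp, Tm.eval_up]

theorem sat_elt (s : Tm Γ Ty.nat) (X : Tm Γ Ty.one) (e : M.Env Γ) :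
    (Fm.elt s X).Sat e ↔ Str.Elt (s.eval e) (X.eval e) := Iff.rfl

theorem sat_setEq (X Y : Tm Γ Ty.one) (e : M.Env Γ) :
    (Fm.setEq X Y).Sat e ↔ Str.SetEq (X.eval e) (Y.eval e) := by
  simp [Fm.setEq, Str.SetEq, sat_elt]

theorem sat_mem (X : Tm Γ Ty.one) (C : Coll Γ) (e : M.Env Γ) :
    (Fm.mem X C).Sat e ↔ C.interp e (X.eval e) := by
  cases C <;> simp [Fm.mem, Coll.interp, Str.MemSeq, sat_setEq]

theorem sat_subColl (C D : Coll Γ) (e : M.Env Γ) :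
    (Fm.subColl C D).Sat e ↔ ∀ X, C.interp e X → D.interp e X := by
  simp [Fm.subColl, sat_mem]

theorem sat_generated (B F : Tm Γ Ty.seq) (b : Tm Γ Ty.one) (U : Tm Γ Ty.two) (e : M.Env Γ) :
    (Fm.generated B F b U).Sat e ↔
      ∀ X, U.eval e ⋄ X = M.zero ↔ Str.Generated (B.eval e) (F.eval e) (b.eval e) X := by
  simp [Fm.generated, sat_mem, sat_setEq, Coll.interp]

/-- The sets `F_j` are infinite and downward directed. -/
def Fm.filterBase (F : Tm Γ Ty.seq) : Fm Γ :=
  .all Ty.nat (.all Ty.nat (.ex Ty.nat (.all Ty.nat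
    (.elt v0 (F.up.up.up.up ⬝ v1) ⇒
      .elt v0 (F.up.up.up.up ⬝ v3) ⩓ .elt v0 (F.up.up.up.up ⬝ v2))))) ⩓
  .all Ty.nat (.infinite (F.up ⬝ v0))

/-- The conclusion of `extensionSentence`, for the sequences `B` and `F`. -/
def Fm.ultrafilterExtension (B F : Tm Γ Ty.seq) : Fm Γ :=
  .ex Ty.one (.ex Ty.two
    (.partialUltrafilter (.enum B.up.up) (.char v0) ⩓
      .subColl (.enum F.up.up) (.char v0) ⩓
      .branch B.up.up F.up.up v1 ⩓
      .generated B.up.up F.up.up v1 v0))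

/-- Every countable filter base of infinite sets that is contained in a countable algebra extends
to a partial non-principal ultrafilter for the algebra that arises from a branch. -/
def filterExtensionSentence : Fm [] :=
  .all Ty.seq (.all Ty.seq
    (.algebra (.enum v1) ⩓ .subColl (.enum v0) (.enum v1) ⩓ .filterBase v0 ⇒
      .ultrafilterExtension v1 v0))

section RCAModel

variable [M.IsRCAModel]

theorem sat_infinite (X : Tm Γ Ty.one) (e : M.Env Γ) :
    (Fm.infinite X).Sat e ↔ Str.Infinite (X.eval e) := by
  simp [Fm.infinite, Str.Infinite, sat_elt, Str.sat_lt]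

theorem sat_filterBase (F : Tm Γ Ty.seq) (e : M.Env Γ) :
    (Fm.filterBase F).Sat e ↔ Str.IsFilterBase (F.eval e) := by
  simp only [Fm.filterBase, Fm.sat_and, Fm.sat_all, Fm.sat_ex, Fm.sat_imp, sat_elt, sat_infinite,
    Tm.eval_app, Tm.eval_up, eval_v0, eval_v1, eval_v2, eval_v3]
  exact ⟨fun h => ⟨h.1, h.2⟩, fun h => ⟨h.directed, h.infinite⟩⟩

theorem sat_algebra (C : Coll Γ) (e : M.Env Γ) :
    (Fm.algebra C).Sat e ↔ Str.IsAlgebra (C.interp e) := by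
  simp only [Fm.algebra, Fm.sat_and, Fm.sat_all, Fm.sat_imp, sat_mem, Coll.interp_up,
    Str.eval_compl, Str.eval_union, Str.eval_inter, eval_v0, eval_v1]
  exact ⟨fun ⟨h₁, h₂, h₃⟩ => ⟨h₁, h₂, h₃⟩, fun h => ⟨h.compl, h.union, h.inter⟩⟩

theorem sat_partialUltrafilter (C F : Coll Γ) (e : M.Env Γ) :
    (Fm.partialUltrafilter C F).Sat e ↔
      Str.IsPartialUltrafilter (C.interp e) (F.interp e) ∧ (Fm.wellDefined F).Sat e := by
  simp only [Fm.partialUltrafilter, Fm.sat_and, Fm.sat_all, Fm.sat_imp, Fm.sat_or, sat_mem,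
    sat_subColl, sat_infinite, Coll.interp_up, Str.eval_compl, Str.eval_inter, eval_v0, eval_v1]
  exact ⟨fun ⟨h₁, h₂, h₃, h₄, h₅, hwd⟩ => ⟨⟨h₁, h₂, h₃, h₄, h₅⟩, hwd⟩,
    fun ⟨⟨h₁, h₂, h₃, h₄, h₅⟩, hwd⟩ => ⟨h₁, h₂, h₃, h₄, h₅, hwd⟩⟩

theorem sat_wellDefined_char (U : Tm Γ Ty.two) (e : M.Env Γ) :
    (Fm.wellDefined (.char U)).Sat e ↔ ∀ X, U.eval e ⋄ X = U.eval e ⋄ Str.normalize X := by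
  simp [Fm.wellDefined, Str.eval_normalize]

theorem sat_branch (B F : Tm Γ Ty.seq) (b : Tm Γ Ty.one) (e : M.Env Γ) :
    (Fm.branch B F b).Sat e ↔ Str.IsBranch (B.eval e) (F.eval e) (b.eval e) := by
  simp only [Fm.branch, Fm.sat_and, Fm.sat_all, Fm.sat_ex, Fm.sat_or, Fm.sat_imp, Fm.sat_iff,
    Fm.sat_eq, sat_elt, Str.sat_lt, Tm.num1, Tm.eval_app, Tm.eval_up, Tm.eval_zero, Tm.eval_succ,
    eval_v0, eval_v1, eval_v2, eval_v4]
  exact ⟨fun h => ⟨h.1, h.2⟩, fun h => ⟨h.zero_or_one, h.realized⟩⟩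

theorem sat_ultrafilterExtension (B F : Tm Γ Ty.seq) (e : M.Env Γ) :
    (Fm.ultrafilterExtension B F).Sat e ↔
      Str.HasUltrafilterExtension (B.eval e) (F.eval e) := by
  simp only [Fm.ultrafilterExtension, Str.HasUltrafilterExtension, Fm.sat_ex, Fm.sat_and,
    sat_partialUltrafilter, sat_wellDefined_char, sat_subColl, sat_branch, sat_generated,
    Coll.interp, Tm.eval_up, eval_v0, eval_v1]

theorem sat_filterExtensionSentence :
    filterExtensionSentence.Sat (.nil : M.Env []) ↔
      ∀ B F : M.C Ty.seq, Str.IsAlgebra (Str.MemSeq B) →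
        (∀ X, Str.MemSeq F X → Str.MemSeq B X) → Str.IsFilterBase F →
          Str.HasUltrafilterExtension B F := by
  simp only [filterExtensionSentence, Fm.sat_all, Fm.sat_imp, Fm.sat_and, sat_algebra,
    sat_subColl, sat_filterBase, sat_ultrafilterExtension, Coll.interp, eval_v0, eval_v1, and_imp]

theorem sat_extensionSentence :
    extensionSentence.Sat (.nil : M.Env []) ↔
      ∀ A F : M.C Ty.seq, Str.IsAlgebra (Str.MemSeq A) ∧
        Str.IsPartialUltrafilter (Str.MemSeq A) (Str.MemSeq F) ∧
        (∀ X, Str.MemSeq F X ↔ Str.MemSeq F (Str.normalize X)) →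
      ∀ B : M.C Ty.seq, Str.IsAlgebra (Str.MemSeq B) ∧
        (∀ X, Str.MemSeq A X → Str.MemSeq B X) → Str.HasUltrafilterExtension B F := by
  change (Fm.all _ (.all _ (_ ⇒ .all _ (_ ⇒ Fm.ultrafilterExtension v0 v1)))).Sat _ ↔ _
  simp only [Fm.sat_all, Fm.sat_imp, Fm.sat_and, sat_algebra, sat_partialUltrafilter,
    sat_subColl, sat_ultrafilterExtension, Fm.wellDefined, Fm.sat_iff, sat_mem, Coll.interp,
    Str.eval_normalize, Tm.eval_up, eval_v0, eval_v1, eval_v2]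

theorem Str.IsPartialUltrafilter.isFilterBase {C : M.C Ty.one → Prop} {F : M.C Ty.seq}
    (hF : Str.IsPartialUltrafilter C (Str.MemSeq F)) : Str.IsFilterBase F where
  directed i j := by
    have hmem (l : M.C Ty.nat) := Str.memSeq_apply F l
    obtain ⟨k, hk⟩ := hF.inter_mem (F ⋄ i) (F ⋄ j)
      ⟨hF.subset _ (hmem i), hF.subset _ (hmem j)⟩ ⟨hmem i, hmem j⟩
    exact ⟨k, fun n hn => Str.elt_inter.1 ((hk n).2 hn)⟩
  infinite j := hF.infinite _ (hF.subset _ (Str.memSeq_apply F j)) (Str.memSeq_apply F j)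

theorem sat_extensionSentence_of_filterExtensionSentence
    (h : filterExtensionSentence.Sat (.nil : M.Env [])) :
    extensionSentence.Sat (.nil : M.Env []) :=
  sat_extensionSentence.2 fun _ F ⟨_, hF, _⟩ B ⟨hB, hAB⟩ =>
    sat_filterExtensionSentence.1 h B F hB (fun X hX => hAB X (hF.subset X hX)) hF.isFilterBase

end RCAModel

end Sentences

theorem RCA.hasEq : RCA.HasEq :=
  ⟨fun _ => .refl, fun _ => .symm, fun _ => .trans, fun _ _ _ => .ext⟩

theorem RCA.der_extensionSentence : Der RCA [filterExtensionSentence] extensionSentence :=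
  der_of_forall_sat RCA.subClosed RCA.hasEq fun _ hext hrca h =>
    have : Str.IsRCAModel _ := ⟨hext, hrca⟩
    sat_extensionSentence_of_filterExtensionSentence (h _ List.mem_cons_self)

end FinTypes

theorem mainTheorem4_general :
    (FinTypes.RCA.Plus FinTypes.muAxiom).Proves FinTypes.filterExtensionSentence :=
  FinTypes.Theory.Plus.proves_of_der <|
    FinTypes.der_of_forall_sat FinTypes.RCA.subClosed FinTypes.RCA.hasEq fun M hext hrca hmu =>
      have : M.IsMuModel := { ext := hext, rca := hrca, mu := hmu _ List.mem_cons_self }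
      FinTypes.sat_filterExtensionSentence.2 fun _ _ => FinTypes.Str.hasUltrafilterExtension

/-- `RCA₀^ω + (μ)` proves that every countable partial non-principal ultrafilter for a countable
algebra extends to a partial non-principal ultrafilter for any countable extension of it. -/
theorem mainTheorem4 :
    (FinTypes.RCA.Plus FinTypes.muAxiom).Proves FinTypes.extensionSentence :=
  .impE (.impI (FinTypes.RCA.der_extensionSentence.mono fun _ _ => .old)) mainTheorem4_general
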